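/- **Conventions.** $A,B$ are C$^*$-algebras with multiplier algebras $M(A),M(B)$. Hilbert C$^*$-modules are right modules with inner product linear in the first variable; $L$ denotes linear maps and $\mathcal L$ adjointable maps, and $\mathcal L(B)=M(B)$. The order on $\mathcal L(E)$ is $T\ge 0\iff\langle Tv,v\rangle\ge0$ for all $v$. A linear map $\rho:A\to M(B)$ is *completely positive* if $\sum_{i,j} b_j^*\rho(a_j^*a_i)b_i\ge 0$ for all finite families $a_i\in A$, $b_i\in B$, and *strict* if it is strictly continuous on bounded sets. **C$^*$-valued weights.** A *C$^*$-valued weight* from $A$ into $M(B)$ is a linear map $\varphi:\mathcal M_\varphi\to M(B)$ on a subspace $\mathcal M_\varphi\subseteq A$ such that $\mathcal M_\varphi^+=\mathcal M_\varphi\cap A^+$ is a hereditary cone in $A^+$, $\mathcal M_\varphi=\operatorname{span}\mathcal M_\varphi^+=\mathcal N_\varphi^*\mathcal N_\varphi$ where $\mathcal N_\varphi=\{a\in A: a^*a\in\mathcal M_\varphi^+\}$, and $\sum_{i,j}b_j^*\varphi(a_j^*a_i)b_i\ge0$ for all finite families $a_i\in\mathcal N_\varphi$, $b_i\in B$. It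 is *densely defined* if $\mathcal M_\varphi$ is dense in $A$. A *KSGNS-construction* for $\varphi$ is a triple $(E,\Lambda,\pi)$ of a Hilbert C$^*$-module $E$ over $B$, a linear map $\Lambda:\mathcal N_\varphi\to\mathcal L(B,E)$ such that the span of the vectors $\Lambda(a)b$ is dense in $E$ and $\langle\Lambda(a_1)b_1,\Lambda(a_2)b_2\rangle=b_2^*\varphi(a_2^*a_1)b_1$, and a $^*$-homomorphism $\pi:A\to\mathcal L(E)$ with $\pi(x)\Lambda(a)=\Lambda(xa)$ for $x\in A$, $a\in\mathcal N_\varphi$. Given a linear map $\Lambda$ from a subspace $N\subseteq A$ into $L(B,E)$, let $\mathcal F$ be the set of strict completely positive maps $\rho:A\to M(B)$ for which there is $T\in\mathcal L(E)$, $0\le T\le 1$, with $b_2^*\rho(a_2^*a_1)b_1=\langle T\Lambda(a_1)b_1,\Lambda(a_2)b_2\rangle$ for all $a_1,a_2\in N$, $b_1,b_2\in B$. Let $\mathcal G=\{\lambda\rho:\lambda\in[0,1),\rho\in\mathcal F\}$, ordered by $\rho_1\le\rho_2\iff\rho_2-\rho_1$ is completely positive. A densely defined C$^*$-valued weight $\varphi$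 with KSGNS-construction $(E,\Lambda,\pi)$ is *lower semi-continuous* if $\mathcal G$ is directed, $\mathcal M_\varphi^+$ is the set of all $x\in A^+$ for which the net $(\rho(x))_{\rho\in\mathcal G}$ is strictly convergent in $M(B)$, and $(\rho(x))_{\rho\in\mathcal G}$ converges strictly to $\varphi(x)$ for every $x\in\mathcal M_\varphi^+$. A *truncating net* for $\Lambda$ is a net $(u_i)_{i\in I}$ in $M(A)$ such that, for every $i$: $Nu_i\subseteq N$; there is a unique $S_i\in\mathcal L(E)$ with $S_i\Lambda(a)=\Lambda(au_i)$ for all $a\in N$; $\|u_i\|\le1$ and $\|S_i\|\le1$; there is a unique strict completely positive linear map $\rho_i:A\to M(B)$ with $b_2^*\rho_i(a_2^*a_1)b_1=\langle S_i\Lambda(a_1)b_1,S_i\Lambda(a_2)b_2\rangle$ for all $a_1,a_2\in N$, $b_1,b_2\in B$; and such that $(u_i)$ converges strictly to $1$ and $(S_i)$ converges strongly to $1$. The weight $\varphi$ is *regular* if it is densely defined, lower semi-continuous, and $\Lambda$ (from its KSGNS-construction) has a truncating net, which is then called a truncating net for $\varphi$. **Statement.** Let $A,B$ be C$^*$-algebras,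 $E$ a Hilbert C$^*$-module over $B$, $N$ a dense left ideal of $A$ and $\Lambda:N\to L(B,E)$ a linear map which is closed for the norm topology on $A$ and the strong topology on $L(B,E)$, such that the span of $\{\Lambda(a)b: a\in N,b\in B\}$ is dense in $E$. Let $(u_i)_{i\in I}$ be a truncating net in $M(A)$ for $\Lambda$. Then $\Lambda(a)\in\mathcal L(B,E)$ for every $a\in N$, and there is a unique well-defined linear map $\varphi:N^*N=\operatorname{span}\{b^*a: a,b\in N\}\to M(B)$ with $$\varphi\Big(\sum_{j=1}^n b_j^*a_j\Big)=\sum_{j=1}^n\Lambda(b_j)^*\Lambda(a_j)\qquad(n\in\mathbb N,\ a_j,b_j\in N).$$ This $\varphi$ is a densely defined C$^*$-valued weight from $A$ into $M(B)$ with $\mathcal N_\varphi=N$. There is a unique $^*$-homomorphism $\pi:A\to\mathcal L(E)$ such that $(E,\Lambda,\pi)$ is a KSGNS-construction for $\varphi$, and $\pi$ is non-degenerate. Moreover $\varphi$ is lower semi-continuous and regular, and $(u_i)_{i\in I}$ is a truncating net for $\varphi$. -/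

import Mathlib

open Filter Topology
open scoped MultiplierAlgebra

universe uI

namespace CStarValued

section HilbertModules

/-!
A (right) Hilbert C*-module over `B` is a complete `E` with `CStarModule Bᵐᵒᵖ E`: the right action
of `b` is `MulOpposite.op b • v`.  Mathlib's inner product is linear in the second variable and takes
values in `Bᵐᵒᵖ`; we pass to the `B`-valued one which is linear in the first variable.
-/

/-- The `B`-valued inner product of a right Hilbert C*-module, linear in the first variable:
`⟨v c, w⟩ = ⟨v, w⟩ c`. -/
def ip (B : Type*) {E : Type*} [Inner Bᵐᵒᵖ E] (v w : E) : B :=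
  MulOpposite.unop (inner Bᵐᵒᵖ w v)

/-- `B` as a right Hilbert C*-module over itself, `⟨b, c⟩ = c* b`. -/
instance selfModule (B : Type*) [NonUnitalCStarAlgebra B] [PartialOrder B] [StarOrderedRing B] :
    CStarModule Bᵐᵒᵖ B where
  inner x y := MulOpposite.op (star x * y)
  inner_add_right {x y z} := by simp [mul_add]
  inner_self_nonneg {x} := by
    change (0 : B) ≤ star x * x
    exact star_mul_self_nonneg x
  inner_self {x} := by
    rw [MulOpposite.op_eq_zero_iff, CStarRing.star_mul_self_eq_zero_iff]
  inner_op_smul_right {a x y} := by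
    apply MulOpposite.unop_injective
    simp [mul_assoc]
  inner_smul_right_complex {z x y} := by simp [mul_smul_comm]
  star_inner x y := by simp [← MulOpposite.op_star]
  norm_eq_sqrt_norm_inner_self x := by
    rw [MulOpposite.norm_op, CStarRing.norm_star_mul_self, Real.sqrt_mul_self (norm_nonneg x)]

/-- `s` is the adjoint of the map `t` between Hilbert C*-modules over `B`. -/
def IsAdjoint (B : Type*) {E F : Type*} [Inner Bᵐᵒᵖ E] [Inner Bᵐᵒᵖ F] (t : E → F) (s : F → E) :
    Prop :=
  ∀ v w, ip B (t v) w = ip B v (s w)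

/-- `t` belongs to `𝓛(E, F)`, the adjointable maps. -/
def IsAdjointable (B : Type*) {E F : Type*} [Inner Bᵐᵒᵖ E] [Inner Bᵐᵒᵖ F] (t : E → F) : Prop :=
  ∃ s : F → E, IsAdjoint B t s

end HilbertModules

/-- The strict topology on the multiplier algebra: the coarsest one for which all maps
`x ↦ x a` and `x ↦ a x` into the normed space `A` are continuous (`x.fst a` is `x a` and `x.snd a`
is `a x`). -/
@[reducible]
noncomputable def strictTopology (A : Type*) [NonUnitalCStarAlgebra A] : TopologicalSpace 𝓜(ℂ, A) :=
  TopologicalSpace.induced (fun (x : 𝓜(ℂ, A)) (a : A) => (x.fst a, x.snd a)) inferInstance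

section Maps

variable {A B : Type*} [NonUnitalCStarAlgebra A] [PartialOrder A] [StarOrderedRing A]
  [NonUnitalCStarAlgebra B] [PartialOrder B] [StarOrderedRing B]

/-- Complete positivity of a linear map from `A` into `M(B)`:
`∑ bⱼ* ρ(aⱼ* aᵢ) bᵢ ≥ 0` for all finite families in `A` and `B`. -/
def IsCP (ρ : A →ₗ[ℂ] 𝓜(ℂ, B)) : Prop :=
  ∀ (n : ℕ) (a : Fin n → A) (b : Fin n → B),
    0 ≤ ∑ i, ∑ j, star (b j) * (ρ (star (a j) * a i)).fst (b i)

/-- Strictness: strict continuity on bounded sets. -/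
def IsStrict (ρ : A →ₗ[ℂ] 𝓜(ℂ, B)) : Prop :=
  ∀ r : ℝ, @ContinuousOn A 𝓜(ℂ, B)
    ((strictTopology A).induced (fun a : A => (a : 𝓜(ℂ, A)))) (strictTopology B)
    ρ (Metric.closedBall 0 r)

/-- A hereditary cone in the positive part of `A`. -/
structure IsHereditaryCone (P : Set A) : Prop where
  nonneg : ∀ x ∈ P, 0 ≤ x
  zero_mem : 0 ∈ P
  add_mem : ∀ x ∈ P, ∀ y ∈ P, x + y ∈ P
  smul_mem : ∀ r : ℝ, 0 ≤ r → ∀ x ∈ P, r • x ∈ P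
  hereditary : ∀ x ∈ P, ∀ y, 0 ≤ y → y ≤ x → y ∈ P

/-- `𝓜_φ⁺`, the positive elements of the domain of `φ`. -/
def posDomain (φ : A →ₗ.[ℂ] 𝓜(ℂ, B)) : Set A := {x | 0 ≤ x ∧ x ∈ φ.domain}

/-- `𝓝_φ = {a | a* a ∈ 𝓜_φ⁺}`. -/
def sqDomain (φ : A →ₗ.[ℂ] 𝓜(ℂ, B)) : Set A := {a | star a * a ∈ posDomain φ}

/-- The partially defined linear map `φ` is a C*-valued weight from `A` into `M(B)`; its domain is
`𝓜_φ` and the hereditary cone is `P = 𝓜_φ⁺`. -/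
structure IsWeight (φ : A →ₗ.[ℂ] 𝓜(ℂ, B)) : Prop where
  hereditaryCone : IsHereditaryCone (posDomain φ)
  domain_eq_span : φ.domain = Submodule.span ℂ (posDomain φ)
  mul_mem : ∀ a ∈ sqDomain φ, ∀ b ∈ sqDomain φ, star b * a ∈ φ.domain
  domain_eq_span_mul :
    φ.domain = Submodule.span ℂ {x | ∃ a ∈ sqDomain φ, ∃ b ∈ sqDomain φ, x = star b * a}
  completelyPositive : ∀ (n : ℕ) (a : Fin n → A) (ha : ∀ i, a i ∈ sqDomain φ) (b : Fin n → B),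
    0 ≤ ∑ i, ∑ j, star (b j) *
      (φ ⟨star (a j) * a i, mul_mem (a i) (ha i) (a j) (ha j)⟩).fst (b i)

/-- `φ` is densely defined. -/
def IsDenselyDefined (φ : A →ₗ.[ℂ] 𝓜(ℂ, B)) : Prop := Dense (φ.domain : Set A)

end Maps

section Constructions

variable {A B E : Type*} [NonUnitalCStarAlgebra A] [PartialOrder A] [StarOrderedRing A]
  [NonUnitalCStarAlgebra B] [PartialOrder B] [StarOrderedRing B]
  [NormedAddCommGroup E] [NormedSpace ℂ E] [CompleteSpace E]
  [SMul Bᵐᵒᵖ E] [CStarModule Bᵐᵒᵖ E]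

/-- The linear map `Λ`, defined on the subspace `Λ.domain` of `A` and with linear maps from `B` to
`E` as values, is closed for the norm topology on `A` and the strong topology (pointwise norm
convergence) on the space of linear maps from `B` to `E`.  Nets in the domain are given by
filters. -/
def IsNormStronglyClosed (Λ : A →ₗ.[ℂ] (B →ₗ[ℂ] E)) : Prop :=
  ∀ (l : Filter Λ.domain) [l.NeBot] (a : A) (t : B →ₗ[ℂ] E),
    Tendsto (fun x : Λ.domain => (x : A)) l (𝓝 a) →
    (∀ b : B, Tendsto (fun x : Λ.domain => Λ x b) l (𝓝 (t b))) →
    ∃ h : a ∈ Λ.domain, Λ ⟨a, h⟩ = t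

/-- The linear span of the vectors `Λ(a) b` is dense in `E`. -/
def HasDenseRange (Λ : A →ₗ.[ℂ] (B →ₗ[ℂ] E)) : Prop :=
  Dense (Submodule.span ℂ {v : E | ∃ (a : Λ.domain) (b : B), v = Λ a b} : Set E)

/-- `(uᵢ)` is a truncating net in `M(A)` for `Λ` (here `(u i).snd a` is the product `a uᵢ`). -/
def IsTruncatingNet {I : Type*} [Preorder I] (Λ : A →ₗ.[ℂ] (B →ₗ[ℂ] E)) (u : I → 𝓜(ℂ, A)) :
    Prop :=
  ∃ (hu : ∀ (i : I) (a : Λ.domain), (u i).snd (a : A) ∈ Λ.domain) (S : I → E →L[ℂ] E),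
    (∀ i, IsAdjointable B (S i) ∧ (∀ a b, S i (Λ a b) = Λ ⟨(u i).snd (a : A), hu i a⟩ b) ∧
      ∀ S' : E →L[ℂ] E, IsAdjointable B S' →
        (∀ a b, S' (Λ a b) = Λ ⟨(u i).snd (a : A), hu i a⟩ b) → S' = S i) ∧
    (∀ i, ‖u i‖ ≤ 1 ∧ ‖S i‖ ≤ 1) ∧
    (∀ i, ∃! ρ : A →ₗ[ℂ] 𝓜(ℂ, B), IsCP ρ ∧ IsStrict ρ ∧
      ∀ (a₁ a₂ : Λ.domain) (b₁ b₂ : B),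
        star b₂ * (ρ (star (a₂ : A) * a₁)).fst b₁ = ip B (S i (Λ a₁ b₁)) (S i (Λ a₂ b₂))) ∧
    Tendsto u atTop (@nhds _ (strictTopology A) 1) ∧
    ∀ v : E, Tendsto (fun i => S i v) atTop (𝓝 v)

/-- `φ` has domain `N* N` (the span of the products `b* a`, where `N` is the domain of `Λ`) and
`φ(∑ bⱼ* aⱼ) = ∑ Λ(bⱼ)* Λ(aⱼ)`.  Here `m ∈ M(B)` is identified with the adjointable operator
`c ↦ m c`, that is `m.fst`, on `B`. -/
structure IsGramMap (Λ : A →ₗ.[ℂ] (B →ₗ[ℂ] E)) (φ : A →ₗ.[ℂ] 𝓜(ℂ, B)) : Prop where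
  domain_eq : φ.domain = Submodule.span ℂ {x | ∃ a ∈ Λ.domain, ∃ b ∈ Λ.domain, x = star b * a}
  map_sum : ∀ (n : ℕ) (a b : Fin n → Λ.domain) (s : Fin n → E → B),
    (∀ j, IsAdjoint B (Λ (b j)) (s j)) →
    ∃ h : ∑ j, star (b j : A) * (a j : A) ∈ φ.domain,
      ∀ c : B, (φ ⟨∑ j, star (b j : A) * (a j : A), h⟩).fst c = ∑ j, s j (Λ (a j) c)

/-- `(E, Λ, π)` is a KSGNS-construction for `φ`. -/
structure IsKSGNS (φ : A →ₗ.[ℂ] 𝓜(ℂ, B)) (Λ : A →ₗ.[ℂ] (B →ₗ[ℂ] E))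
    (π : A →ₙₐ[ℂ] (E →L[ℂ] E)) : Prop where
  domain_eq : (Λ.domain : Set A) = sqDomain φ
  adjointable : ∀ a, IsAdjointable B (Λ a)
  denseRange : HasDenseRange Λ
  inner_eq : ∀ (a₁ a₂ : Λ.domain) (b₁ b₂ : B), ∃ h : star (a₂ : A) * (a₁ : A) ∈ φ.domain,
    ip B (Λ a₁ b₁) (Λ a₂ b₂) = star b₂ * (φ ⟨star (a₂ : A) * (a₁ : A), h⟩).fst b₁
  /-- Every `π x` is adjointable, and `(π x)* = π (x*)`. -/
  star_map : ∀ x : A, IsAdjoint B (π x) (π (star x))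
  map_apply : ∀ (x : A) (a : Λ.domain), ∃ h : x * (a : A) ∈ Λ.domain,
    ∀ b : B, π x (Λ a b) = Λ ⟨x * (a : A), h⟩ b

/-- `π` is non-degenerate: the vectors `π(x) v` span a dense subspace. -/
def IsNondegenerate (π : A →ₙₐ[ℂ] (E →L[ℂ] E)) : Prop :=
  Dense (Submodule.span ℂ {w : E | ∃ (x : A) (v : E), w = π x v} : Set E)

/-- The strict completely positive maps `ρ` from `A` into `M(B)` for which there is an operator
`T` in `𝓛(E)` with `0 ≤ T ≤ 1` and `b₂* ρ(a₂* a₁) b₁ = ⟨T Λ(a₁) b₁, Λ(a₂) b₂⟩`. -/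
def familyF (Λ : A →ₗ.[ℂ] (B →ₗ[ℂ] E)) : Set (A →ₗ[ℂ] 𝓜(ℂ, B)) :=
  {ρ | IsCP ρ ∧ IsStrict ρ ∧ ∃ T : E →L[ℂ] E, IsAdjointable B T ∧
    (∀ v, 0 ≤ ip B (T v) v) ∧ (∀ v, ip B (T v) v ≤ ip B v v) ∧
    ∀ (a₁ a₂ : Λ.domain) (b₁ b₂ : B),
      star b₂ * (ρ (star (a₂ : A) * a₁)).fst b₁ = ip B (T (Λ a₁ b₁)) (Λ a₂ b₂)}

/-- The maps `t ρ` with `t ∈ [0, 1)` and `ρ` in `familyF Λ`. -/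
def familyG (Λ : A →ₗ.[ℂ] (B →ₗ[ℂ] E)) : Set (A →ₗ[ℂ] 𝓜(ℂ, B)) :=
  {ρ | ∃ t : ℝ, 0 ≤ t ∧ t < 1 ∧ ∃ σ ∈ familyF Λ, ρ = (t : ℂ) • σ}

/-- The filter of tails of `familyG Λ`, ordered by `ρ₁ ≤ ρ₂` iff `ρ₂ - ρ₁` is completely positive.
As this ordered set is non-empty and directed, a limit along this filter is the limit of the net
indexed by `familyG Λ`. -/
def netG (Λ : A →ₗ.[ℂ] (B →ₗ[ℂ] E)) : Filter (A →ₗ[ℂ] 𝓜(ℂ, B)) :=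
  ⨅ ρ₀ ∈ familyG Λ, 𝓟 {ρ | ρ ∈ familyG Λ ∧ IsCP (ρ - ρ₀)}

/-- Lower semi-continuity of a densely defined C*-valued weight `φ`, for which `Λ` belongs to a
KSGNS-construction.  The first field says that the nets in the other two are indexed by a directed
set. -/
structure IsLowerSemicontinuous (φ : A →ₗ.[ℂ] 𝓜(ℂ, B)) (Λ : A →ₗ.[ℂ] (B →ₗ[ℂ] E)) :
    Prop where
  directed : DirectedOn (fun ρ₁ ρ₂ => IsCP (ρ₂ - ρ₁)) (familyG Λ)
  posDomain_eq : posDomain φ = {x : A | 0 ≤ x ∧ ∃ m : 𝓜(ℂ, B),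
    Tendsto (fun ρ : A →ₗ[ℂ] 𝓜(ℂ, B) => ρ x) (netG Λ) (@nhds _ (strictTopology B) m)}
  tendsto : ∀ x : φ.domain, 0 ≤ (x : A) →
    Tendsto (fun ρ : A →ₗ[ℂ] 𝓜(ℂ, B) => ρ x) (netG Λ) (@nhds _ (strictTopology B) (φ x))

/-- Regularity of a C*-valued weight `φ`, for which `Λ` belongs to a KSGNS-construction. -/
def IsRegular (φ : A →ₗ.[ℂ] 𝓜(ℂ, B)) (Λ : A →ₗ.[ℂ] (B →ₗ[ℂ] E)) : Prop :=
  IsDenselyDefined φ ∧ IsLowerSemicontinuous φ Λ ∧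
    ∃ (J : Type uI) (_ : Preorder J) (_ : IsDirectedOrder J) (_ : Nonempty J) (v : J → 𝓜(ℂ, A)),
      IsTruncatingNet Λ v

end Constructions

end CStarValued

/-! Everything is obtained by letting i grow in facts about ρ_i(x) = φ(u_i* x u_i), which is norm
continuous and defined on all of A. The link is ‖S_i Λ(a)b‖² = ‖b* ρ_i(a* a) b‖ (`norm_sq_S_apply`):
it makes S_i Λ continuous, whereas Λ is only closed. Banach–Steinhaus then bounds Λ(a), and its
adjoint exists on the dense span of the vectors S_i* S_i Λ(a')b' (`isAdjointable`). On N* N the ρ_i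
converge strictly, because ρ_i(b* a) = Λ(b)* S_i* S_i Λ(a) and S_i* S_i → 1 strongly. The limit is
φ, which is therefore well defined.

Closedness of Λ gives A u_i ⊆ N. If a* a ≤ ∑ c_k* c_k with c_k ∈ N, then Λ(a(u_i − u_j))b is
controlled by the vectors (S_i − S_j)Λ(c_k)b, so Λ(a u_i)b converges and a ∈ N
(`mem_of_star_mul_le`). This gives heredity and 𝓝_φ = N. Left multiplication is symmetric for the
form ⟨Λ(a)b, Λ(c)d⟩, again by passing to the limit, and bounded by ‖x‖ (`norm_tensorMul_le`); it
extends to π.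

For lower semi-continuity, elements of `familyG Λ` are given by positive operators T of norm < 1 in
the commutant of π(A). Two of these have an upper bound R of the same kind with R ≤ C(T₁ + T₂)
(`exists_common_bound`). This domination makes R come from a strict map V* π(·) V, where V plays the
role of R^{1/2} Λ(1) (`exists_isGivenBy`). Hence directedness. Along the net the operators T tend
strongly to 1, which gives the limits on N* N. Conversely, if the net converges at a* a, some fixed
T is nearly the identity on Λ(a u_i)b for all late i, while T Λ(a u_i)b is Cauchy; so Λ(a u_i)b is
Cauchy and a ∈ N (`mem_of_tendsto_netG`). -/

set_option linter.unusedSectionVars false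

namespace CStarValued

/-! ### Calculus of the `B`-valued inner product. -/

section InnerProduct

variable {B E : Type*} [NonUnitalCStarAlgebra B] [PartialOrder B] [StarOrderedRing B]
  [NormedAddCommGroup E] [NormedSpace ℂ E] [SMul Bᵐᵒᵖ E] [CStarModule Bᵐᵒᵖ E]

@[simp] lemma ip_self_module (b c : B) : ip B b c = star c * b := rfl

lemma ip_add_left (v w x : E) : ip B (v + w) x = ip B v x + ip B w x := by
  simp [ip]

lemma ip_add_right (v w x : E) : ip B v (w + x) = ip B v w + ip B v x := by
  simp [ip]

lemma ip_smul_left (z : ℂ) (v w : E) : ip B (z • v) w = z • ip B v w := by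
  simp [ip]

lemma ip_smul_right (z : ℂ) (v w : E) : ip B v (z • w) = star z • ip B v w := by
  simp [ip, CStarModule.inner_smul_left_complex]

@[simp] lemma star_ip (v w : E) : star (ip B v w) = ip B w v := by
  simp [ip, ← MulOpposite.unop_star]

variable (B) in
/-- The inner product as a linear map in its first variable. -/
def ipLin (w : E) : E →ₗ[ℂ] B where
  toFun v := ip B v w
  map_add' v v' := ip_add_left v v' w
  map_smul' z v := ip_smul_left z v w

@[simp] lemma ip_zero_left (w : E) : ip B 0 w = 0 := (ipLin B w).map_zero

lemma ip_sub_left (v w x : E) : ip B (v - w) x = ip B v x - ip B w x := (ipLin B x).map_sub v w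

lemma ip_neg_left (v x : E) : ip B (-v) x = -ip B v x := (ipLin B x).map_neg v

lemma ip_sum_left {ι : Type*} (s : Finset ι) (f : ι → E) (x : E) :
    ip B (∑ i ∈ s, f i) x = ∑ i ∈ s, ip B (f i) x := map_sum (ipLin B x) f s

@[simp] lemma ip_zero_right (w : E) : ip B w 0 = 0 := by
  rw [← star_ip, ip_zero_left, star_zero]

lemma ip_sub_right (v w x : E) : ip B v (w - x) = ip B v w - ip B v x := by
  rw [← star_ip, ip_sub_left, star_sub, star_ip, star_ip]

lemma ip_sum_right {ι : Type*} (s : Finset ι) (f : ι → E) (x : E) :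
    ip B x (∑ i ∈ s, f i) = ∑ i ∈ s, ip B x (f i) := by
  rw [← star_ip, ip_sum_left, star_sum]; simp

lemma ip_real_smul_left (r : ℝ) (v w : E) : ip B ((r : ℂ) • v) w = r • ip B v w := by
  rw [ip_smul_left, Complex.coe_smul]

lemma ip_real_smul_right (r : ℝ) (v w : E) : ip B v ((r : ℂ) • w) = r • ip B v w := by
  rw [← star_ip, ip_real_smul_left, star_smul, star_ip, star_trivial]

lemma ip_self_nonneg (v : E) : 0 ≤ ip B v v :=
  MulOpposite.unop_nonneg.2 CStarModule.inner_self_nonneg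

lemma norm_ip_le (v w : E) : ‖ip B v w‖ ≤ ‖v‖ * ‖w‖ := by
  rw [mul_comm, ip, MulOpposite.norm_unop]
  exact CStarModule.norm_inner_le E

lemma norm_ip_self (v : E) : ‖ip B v v‖ = ‖v‖ ^ 2 := by
  rw [ip, MulOpposite.norm_unop, CStarModule.norm_sq_eq Bᵐᵒᵖ]

lemma ip_self_eq_zero {v : E} : ip B v v = 0 ↔ v = 0 := by
  rw [← norm_eq_zero, norm_ip_self]; simp

lemma eq_of_forall_ip_left {v w : E} (h : ∀ x, ip B v x = ip B w x) : v = w := by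
  rw [← sub_eq_zero, ← ip_self_eq_zero (B := B), ip_sub_left, h, sub_self]

lemma eq_of_forall_ip_right {v w : E} (h : ∀ x, ip B x v = ip B x w) : v = w :=
  eq_of_forall_ip_left (B := B) fun x => by rw [← star_ip, h, star_ip]

lemma continuous_ip : Continuous fun p : E × E => ip B p.1 p.2 := by
  have : Continuous fun p : E × E => inner Bᵐᵒᵖ p.1 p.2 := CStarModule.continuous_inner
  exact MulOpposite.continuous_unop.comp (this.comp continuous_swap)

lemma tendsto_ip {ι : Type*} {l : Filter ι} {f g : ι → E} {v w : E} (hf : Tendsto f l (𝓝 v))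
    (hg : Tendsto g l (𝓝 w)) : Tendsto (fun i => ip B (f i) (g i)) l (𝓝 (ip B v w)) :=
  (continuous_ip.tendsto (v, w)).comp (hf.prodMk_nhds hg)

/-- Two vectors agree if their inner products with a set of dense span agree. -/
lemma eq_of_forall_ip_dense {D : Set E} (hD : Dense (Submodule.span ℂ D : Set E)) {v w : E}
    (h : ∀ x ∈ D, ip B v x = ip B w x) : v = w := by
  refine eq_of_forall_ip_left (B := B) fun x => ?_
  have h2 : ∀ x ∈ Submodule.span ℂ D, ip B v x = ip B w x := fun x hx => by
    induction hx using Submodule.span_induction with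
    | mem x hx => exact h x hx
    | zero => simp
    | add x y _ _ hx hy => rw [ip_add_right, ip_add_right, hx, hy]
    | smul z x _ hx => rw [ip_smul_right, ip_smul_right, hx]
  have h3 : Set.EqOn (fun x => ip B v x) (fun x => ip B w x)
      (closure (Submodule.span ℂ D : Set E)) :=
    Set.EqOn.closure h2 (continuous_ip.comp (by fun_prop : Continuous fun x : E => (v, x)))
      (continuous_ip.comp (by fun_prop : Continuous fun x : E => (w, x)))
  exact h3 (hD x)

/-- Polarization: a linear map is determined by its quadratic form. -/
lemma eq_zero_of_forall_ip_self {D : E →ₗ[ℂ] E} (h : ∀ v, ip B (D v) v = 0) (v : E) : D v = 0 := by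
  refine eq_of_forall_ip_left (B := B) fun w => ?_
  -- The first identity says ⟨Dv, w⟩ + ⟨Dw, v⟩ = 0, the second that these two terms are equal.
  have h1 := h (v + w)
  have h2 := h (v + Complex.I • w)
  simp only [map_add, map_smul, ip_add_left, ip_add_right, ip_smul_left, ip_smul_right, h,
    smul_zero, zero_add, add_zero, RCLike.star_def, Complex.conj_I, neg_smul] at h1 h2
  have h3 : ip B (D w) v = ip B (D v) w := by
    exact smul_right_injective B Complex.I_ne_zero (add_neg_eq_zero.1 h2)
  rw [h3, ← two_smul ℂ] at h1
  simpa using h1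

end InnerProduct

/-! ### Adjoints of maps between Hilbert modules. -/

section Adjoint

variable {B E F G : Type*} [NonUnitalCStarAlgebra B] [PartialOrder B] [StarOrderedRing B]
  [NormedAddCommGroup E] [NormedSpace ℂ E] [SMul Bᵐᵒᵖ E] [CStarModule Bᵐᵒᵖ E]
  [NormedAddCommGroup F] [NormedSpace ℂ F] [SMul Bᵐᵒᵖ F] [CStarModule Bᵐᵒᵖ F]
  [NormedAddCommGroup G] [NormedSpace ℂ G] [SMul Bᵐᵒᵖ G] [CStarModule Bᵐᵒᵖ G]

lemma IsAdjoint.symm {t : E → F} {s : F → E} (h : IsAdjoint B t s) : IsAdjoint B s t :=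
  fun v w => by rw [← star_ip, ← h, star_ip]

lemma IsAdjoint.comp {t : E → F} {s : F → E} {t' : F → G} {s' : G → F} (h' : IsAdjoint B t' s')
    (h : IsAdjoint B t s) : IsAdjoint B (t' ∘ t) (s ∘ s') :=
  fun _ _ => (h' _ _).trans (h _ _)

lemma IsAdjoint.unique {t : E → F} {s s' : F → E} (h : IsAdjoint B t s) (h' : IsAdjoint B t s') :
    s = s' :=
  funext fun w => eq_of_forall_ip_right (B := B) fun v => by rw [← h, h']

lemma IsAdjoint.map_add {t : E → F} {s : F → E} (h : IsAdjoint B t s) (v w : E) :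
    t (v + w) = t v + t w :=
  eq_of_forall_ip_left (B := B) fun x => by simp only [ip_add_left, h _ _]

lemma IsAdjoint.map_smul {t : E → F} {s : F → E} (h : IsAdjoint B t s) (z : ℂ) (v : E) :
    t (z • v) = z • t v :=
  eq_of_forall_ip_left (B := B) fun x => by simp only [ip_smul_left, h _ _]

/-- An adjointable map is linear and bounded. -/
noncomputable def IsAdjoint.toCLM [CompleteSpace E] [CompleteSpace F] {t : E → F} {s : F → E}
    (h : IsAdjoint B t s) : E →L[ℂ] F :=
  ContinuousLinearMap.ofSeqClosedGraph
    (g := { toFun := t, map_add' := h.map_add, map_smul' := h.map_smul })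
    fun u x y hu hy => by
      refine eq_of_forall_ip_left (B := B) fun w => ?_
      have h1 : Tendsto (fun n => ip B (t (u n)) w) atTop (𝓝 (ip B y w)) :=
        tendsto_ip hy tendsto_const_nhds
      have h2 : Tendsto (fun n => ip B (t (u n)) w) atTop (𝓝 (ip B x (s w))) := by
        simp only [h _ _]
        exact tendsto_ip hu tendsto_const_nhds
      exact (tendsto_nhds_unique h1 h2).trans (h x w).symm

@[simp] lemma IsAdjoint.toCLM_apply [CompleteSpace E] [CompleteSpace F] {t : E → F} {s : F → E}
    (h : IsAdjoint B t s) (v : E) : h.toCLM v = t v := rfl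

/-- Take b = c and use Cauchy–Schwarz. The bound makes values of a partially known adjoint Cauchy
whenever their arguments are. -/
lemma norm_le_of_forall_ip_eq {t : F →L[ℂ] E} {v : E} {c : F}
    (hc : ∀ b, ip B (t b) v = ip B b c) : ‖c‖ ≤ ‖t‖ * ‖v‖ := by
  rcases (norm_nonneg c).eq_or_lt with h0 | h0
  · rw [← h0]; positivity
  refine le_of_mul_le_mul_right ?_ h0
  calc ‖c‖ * ‖c‖ = ‖ip B (t c) v‖ := by rw [hc, norm_ip_self, sq]
    _ ≤ ‖t c‖ * ‖v‖ := norm_ip_le _ _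
    _ ≤ ‖t‖ * ‖c‖ * ‖v‖ := by gcongr; exact t.le_opNorm c
    _ = ‖t‖ * ‖v‖ * ‖c‖ := by ring

/-- A bounded map has an adjoint if its adjoint exists on a dense set. -/
lemma isAdjointable_of_dense [CompleteSpace F] (t : F →L[ℂ] E) {D : Set E}
    (hD : Dense (Submodule.span ℂ D : Set E))
    (h : ∀ v ∈ D, ∃ c : F, ∀ b, ip B (t b) v = ip B b c) : IsAdjointable B t := by
  have h1 : ∀ v ∈ Submodule.span ℂ D, ∃ c : F, ∀ b, ip B (t b) v = ip B b c := fun v hv => by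
    induction hv using Submodule.span_induction with
    | mem x hx => exact h x hx
    | zero => exact ⟨0, by simp⟩
    | add x y _ _ hx hy =>
      obtain ⟨c, hc⟩ := hx
      obtain ⟨d, hd⟩ := hy
      exact ⟨c + d, fun b => by rw [ip_add_right, ip_add_right, hc, hd]⟩
    | smul z x _ hx =>
      obtain ⟨c, hc⟩ := hx
      exact ⟨z • c, fun b => by rw [ip_smul_right, ip_smul_right, hc]⟩
  have h2 : ∀ v : E, ∃ c : F, ∀ b, ip B (t b) v = ip B b c := fun v => by
    obtain ⟨x, hx, hxv⟩ := mem_closure_iff_seq_limit.1 (hD v)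
    choose c hc using fun n => h1 (x n) (hx n)
    -- The adjoint is Lipschitz where it is known. The summand 1 in the denominator covers t = 0.
    have hcauchy : CauchySeq c := by
      rw [Metric.cauchySeq_iff]
      intro ε hε
      obtain ⟨N, hN⟩ := Metric.cauchySeq_iff.1 hxv.cauchySeq (ε / (‖t‖ + 1)) (by positivity)
      refine ⟨N, fun m hm n hn => ?_⟩
      have h3 := norm_le_of_forall_ip_eq (B := B) (t := t) (v := x m - x n)
        (c := c m - c n) fun b => by rw [ip_sub_right, ip_sub_right, hc, hc]
      have h4 := hN m hm n hn
      rw [dist_eq_norm] at h4 ⊢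
      rw [lt_div_iff₀ (by positivity)] at h4
      nlinarith [norm_nonneg (x m - x n)]
    obtain ⟨d, hd⟩ := cauchySeq_tendsto_of_complete hcauchy
    refine ⟨d, fun b => ?_⟩
    have h3 : Tendsto (fun n => ip B (t b) (x n)) atTop (𝓝 (ip B (t b) v)) :=
      tendsto_ip tendsto_const_nhds hxv
    simp only [hc] at h3
    exact tendsto_nhds_unique h3 (tendsto_ip tendsto_const_nhds hd)
  choose s hs using h2
  exact ⟨s, fun v w => hs w v⟩

end Adjoint

/-! ### The C*-algebra of adjointable operators and its order. -/

section AdjointableOperators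

variable (B E : Type*) [NonUnitalCStarAlgebra B] [PartialOrder B] [StarOrderedRing B]
  [NormedAddCommGroup E] [NormedSpace ℂ E] [SMul Bᵐᵒᵖ E] [CStarModule Bᵐᵒᵖ E]

/-- The subalgebra of adjointable operators on a Hilbert module. -/
def adjointableSubalgebra [CompleteSpace E] : Subalgebra ℂ (E →L[ℂ] E) where
  carrier := {t | IsAdjointable B t}
  mul_mem' {t t'} := fun ⟨s, hs⟩ ⟨s', hs'⟩ => ⟨s' ∘ s, hs.comp hs'⟩
  add_mem' {t t'} := fun ⟨s, hs⟩ ⟨s', hs'⟩ => ⟨s + s', fun v w => by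
    simpa [ip_add_left, ip_add_right] using congr_arg₂ (· + ·) (hs v w) (hs' v w)⟩
  algebraMap_mem' z := ⟨fun v => star z • v, fun v w => by
    simp [Algebra.algebraMap_eq_smul_one, ip_smul_left, ip_smul_right]⟩

/-- The C*-algebra of adjointable operators on a Hilbert module. -/
def Adjointable [CompleteSpace E] : Type _ := adjointableSubalgebra B E

namespace Adjointable

variable [CompleteSpace E]

noncomputable instance : NormedRing (Adjointable B E) :=
  inferInstanceAs (NormedRing (adjointableSubalgebra B E))

noncomputable instance : NormedAlgebra ℂ (Adjointable B E) :=
  inferInstanceAs (NormedAlgebra ℂ (adjointableSubalgebra B E))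

variable {B E}

/-- The underlying bounded operator. -/
def toCLM (a : Adjointable B E) : E →L[ℂ] E := a.1

lemma toCLM_injective : Function.Injective (toCLM : Adjointable B E → E →L[ℂ] E) :=
  Subtype.val_injective

/-- The adjointable operator with a given adjoint. -/
def mk' (t s : E →L[ℂ] E) (h : IsAdjoint B t s) : Adjointable B E := ⟨t, s, h⟩

@[simp] lemma toCLM_mk' (t s : E →L[ℂ] E) (h : IsAdjoint B t s) : (mk' t s h).toCLM = t := rfl

/-- Adjoints are unique, so the choice is immaterial; the chosen map is bounded by the closed graph
theorem. -/
noncomputable instance : Star (Adjointable B E) :=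
  ⟨fun a => mk' a.2.choose_spec.symm.toCLM a.toCLM a.2.choose_spec.symm⟩

lemma isAdjoint (a : Adjointable B E) : IsAdjoint B a.toCLM (star a).toCLM := a.2.choose_spec

lemma eq_star_of_isAdjoint {a b : Adjointable B E} (h : IsAdjoint B a.toCLM b.toCLM) :
    star a = b :=
  toCLM_injective (DFunLike.coe_injective ((isAdjoint a).unique h))

@[simp] lemma toCLM_add (a b : Adjointable B E) : (a + b).toCLM = a.toCLM + b.toCLM := rfl
@[simp] lemma toCLM_sub (a b : Adjointable B E) : (a - b).toCLM = a.toCLM - b.toCLM := rfl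
@[simp] lemma toCLM_neg (a : Adjointable B E) : (-a).toCLM = -a.toCLM := rfl
@[simp] lemma toCLM_mul (a b : Adjointable B E) : (a * b).toCLM = a.toCLM * b.toCLM := rfl
@[simp] lemma toCLM_one : (1 : Adjointable B E).toCLM = 1 := rfl
@[simp] lemma toCLM_zero : (0 : Adjointable B E).toCLM = 0 := rfl
@[simp] lemma toCLM_smul (z : ℂ) (a : Adjointable B E) : (z • a).toCLM = z • a.toCLM := rfl

noncomputable instance : StarRing (Adjointable B E) where
  star_involutive a := eq_star_of_isAdjoint (isAdjoint a).symm
  star_mul a b := eq_star_of_isAdjoint ((isAdjoint a).comp (isAdjoint b))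
  star_add a b := eq_star_of_isAdjoint fun v w => by
    simp [ip_add_left, ip_add_right, isAdjoint a v w, isAdjoint b v w]

instance : StarModule ℂ (Adjointable B E) where
  star_smul z a := eq_star_of_isAdjoint fun v w => by
    simp [ip_smul_left, ip_smul_right, isAdjoint a v w]

lemma norm_eq (a : Adjointable B E) : ‖a‖ = ‖a.toCLM‖ := rfl

/-- Cauchy–Schwarz applied to ⟨av, av⟩ = ⟨v, a* a v⟩. -/
lemma norm_sq_toCLM_le (a : Adjointable B E) :
    ‖a.toCLM‖ * ‖a.toCLM‖ ≤ ‖(star a * a).toCLM‖ := by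
  have h : ‖a.toCLM‖ ≤ √‖(star a * a).toCLM‖ := by
    refine ContinuousLinearMap.opNorm_le_bound _ (Real.sqrt_nonneg _) fun v => ?_
    refine Real.le_sqrt_of_sq_le ?_ |>.trans_eq ?_ (b := √(‖(star a * a).toCLM‖ * ‖v‖ ^ 2))
    · rw [← norm_ip_self (B := B), isAdjoint a, sq, ← mul_assoc]
      calc _ = ‖ip B v ((star a * a).toCLM v)‖ := rfl
        _ ≤ ‖v‖ * ‖(star a * a).toCLM v‖ := norm_ip_le _ _
        _ ≤ ‖v‖ * (‖(star a * a).toCLM‖ * ‖v‖) := by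
          gcongr; exact ContinuousLinearMap.le_opNorm _ _
        _ = _ := by ring
    · rw [Real.sqrt_mul (norm_nonneg _), Real.sqrt_sq (norm_nonneg _)]
  calc _ ≤ √‖(star a * a).toCLM‖ * √‖(star a * a).toCLM‖ := by gcongr
    _ = _ := Real.mul_self_sqrt (norm_nonneg _)

instance : CStarRing (Adjointable B E) where
  norm_mul_self_le a := norm_sq_toCLM_le a

/-- The adjointable operators are norm closed: along a convergent sequence of operators the adjoints
are pointwise Cauchy, and their limit is an adjoint of the limit. -/
instance : CompleteSpace (Adjointable B E) := by
  have : IsClosed ((adjointableSubalgebra B E : Subalgebra ℂ _) : Set (E →L[ℂ] E)) := by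
    rw [← isSeqClosed_iff_isClosed]
    intro T t hT hTt
    choose S hS using hT
    have hcauchy : ∀ w, CauchySeq fun n => S n w := fun w => by
      rw [Metric.cauchySeq_iff]
      intro ε hε
      obtain ⟨N, hN⟩ := Metric.cauchySeq_iff.1 hTt.cauchySeq (ε / (‖w‖ + 1)) (by positivity)
      refine ⟨N, fun m hm n hn => ?_⟩
      have h3 := norm_le_of_forall_ip_eq (B := B) (t := T m - T n) (v := w)
          (c := S m w - S n w) fun b => by
        rw [ip_sub_right, ← hS m, ← hS n, ← ip_sub_left]; rfl
      have h4 := hN m hm n hn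
      rw [dist_eq_norm] at h4 ⊢
      rw [lt_div_iff₀ (by positivity)] at h4
      nlinarith [norm_nonneg (T m - T n)]
    choose s hs using fun w => cauchySeq_tendsto_of_complete (hcauchy w)
    refine ⟨s, fun v w => ?_⟩
    have h1 : Tendsto (fun n => ip B (T n v) w) atTop (𝓝 (ip B (t v) w)) :=
      tendsto_ip (((ContinuousLinearMap.apply ℂ E v).continuous.tendsto t).comp hTt)
        tendsto_const_nhds
    simp only [hS _ _ _] at h1
    exact tendsto_nhds_unique h1 (tendsto_ip tendsto_const_nhds (hs w))
  exact this.completeSpace_coe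

noncomputable instance : CStarAlgebra (Adjointable B E) where

noncomputable instance : PartialOrder (Adjointable B E) :=
  CStarAlgebra.spectralOrder _

noncomputable instance : StarOrderedRing (Adjointable B E) :=
  CStarAlgebra.spectralOrderedRing _

lemma exists_toCLM_eq {t : E →L[ℂ] E} (h : IsAdjointable B t) :
    ∃ a : Adjointable B E, a.toCLM = t :=
  ⟨⟨t, h⟩, rfl⟩

lemma ip_star_mul_self (a : Adjointable B E) (v : E) :
    ip B ((star a * a).toCLM v) v = ip B (a.toCLM v) (a.toCLM v) := by
  simpa using isAdjoint (star a) (a.toCLM v) v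

lemma eq_zero_of_forall_ip {a : Adjointable B E} (h : ∀ v, ip B (a.toCLM v) v = 0) : a = 0 :=
  toCLM_injective (ContinuousLinearMap.ext fun v =>
    eq_zero_of_forall_ip_self (B := B) (D := a.toCLM.toLinearMap) h v)

/-- Identifies the spectral order with the order of the statement. Conversely to the easy direction,
polarization makes `a` self-adjoint; with n its negative part, n a n = −n³ has a nonnegative form
while n³ ≥ 0, so n³ = 0 and n = 0. -/
lemma nonneg_iff {a : Adjointable B E} : 0 ≤ a ↔ ∀ v, 0 ≤ ip B (a.toCLM v) v := by
  constructor
  · intro h v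
    obtain ⟨b, rfl⟩ := CStarAlgebra.nonneg_iff_eq_star_mul_self.1 h
    rw [ip_star_mul_self]
    exact ip_self_nonneg _
  · intro h
    have hsa : IsSelfAdjoint a := by
      rw [isSelfAdjoint_iff, ← sub_eq_zero]
      refine eq_zero_of_forall_ip fun v => ?_
      have h1 : star (ip B (a.toCLM v) v) = ip B (a.toCLM v) v := (h v).isSelfAdjoint
      rw [star_ip] at h1
      change ip B ((star a).toCLM v - a.toCLM v) v = 0
      rw [ip_sub_left, isAdjoint (star a), star_star, h1, sub_self]
    set p := a⁺
    set n := a⁻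
    have hn : 0 ≤ n := CFC.negPart_nonneg a
    have hns : star n = n := hn.isSelfAdjoint
    have hpn : p * n = 0 := CFC.posPart_mul_negPart a
    have ha : a = p - n := (CFC.posPart_sub_negPart a hsa).symm
    have h3 : n * a * n = -(n * n * n) := by
      rw [ha, mul_sub, sub_mul, mul_assoc, hpn]; simp
    have h4 : n * n * n = 0 := by
      refine eq_zero_of_forall_ip fun v => le_antisymm ?_ ?_
      · have h5 : ip B ((n * a * n).toCLM v) v = ip B (a.toCLM (n.toCLM v)) (n.toCLM v) := by
          have := isAdjoint (star n) (a.toCLM (n.toCLM v)) v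
          rwa [star_star, hns] at this
        have h6 := h (n.toCLM v)
        rw [← h5, h3, toCLM_neg, neg_apply, ip_neg_left] at h6
        exact neg_nonneg.1 h6
      · have h5 : n * n * n = star (CFC.sqrt n * n) * (CFC.sqrt n * n) := by
          rw [star_mul, hns, (CFC.sqrt_nonneg n).isSelfAdjoint.star_eq]
          rw [mul_assoc n (CFC.sqrt n), ← mul_assoc (CFC.sqrt n), CFC.sqrt_mul_sqrt_self n hn,
            mul_assoc]
        rw [h5, ip_star_mul_self]
        exact ip_self_nonneg _
    have h5 : n * n = 0 := by
      rw [← CStarRing.star_mul_self_eq_zero_iff, star_mul, hns, ← mul_assoc, h4, zero_mul]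
    have h6 : n = 0 := by
      rw [← CStarRing.star_mul_self_eq_zero_iff, hns, h5]
    rw [ha, h6, sub_zero]
    exact CFC.posPart_nonneg a

lemma le_iff {a b : Adjointable B E} :
    a ≤ b ↔ ∀ v, ip B (a.toCLM v) v ≤ ip B (b.toCLM v) v := by
  rw [← sub_nonneg, nonneg_iff]
  simp [ip_sub_left]

/-- An operator between `0` and `1` satisfies `T² ≤ T`. -/
lemma ip_apply_self_le {a : Adjointable B E} (h0 : 0 ≤ a) (h1 : a ≤ 1) (v : E) :
    ip B (a.toCLM v) (a.toCLM v) ≤ ip B (a.toCLM v) v := by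
  have hs := h0.isSelfAdjoint.star_eq
  have h : star a * a ≤ a := by
    rw [hs]
    have := CStarAlgebra.pow_antitone h0 h1 one_le_two
    simpa [sq] using this
  rw [← ip_star_mul_self]
  exact le_iff.1 h v

lemma ip_apply_self_le_of_norm_le_one {a : Adjointable B E} (h : ‖a‖ ≤ 1) (v : E) :
    ip B (a.toCLM v) (a.toCLM v) ≤ ip B v v := by
  rw [← ip_star_mul_self]
  suffices h : star a * a ≤ 1 from le_iff.1 h v
  rw [← CStarAlgebra.norm_le_one_iff_of_nonneg _ (star_mul_self_nonneg a),
    CStarRing.norm_star_mul_self]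
  nlinarith [norm_nonneg a]

end Adjointable
end AdjointableOperators

/-! ### Multipliers, strict convergence, strict and completely positive maps. -/

section Multiplier

variable {A B : Type*} [NonUnitalCStarAlgebra A] [PartialOrder A] [StarOrderedRing A]
  [NonUnitalCStarAlgebra B] [PartialOrder B] [StarOrderedRing B]

lemma star_mul_fst (m : 𝓜(ℂ, B)) (b c : B) : b * m.fst c = m.snd b * c := (m.central b c).symm

/-- The right action is recovered from the left one through `b * m.fst c = m.snd b * c`. -/
lemma multiplier_ext {m n : 𝓜(ℂ, B)} (h : ∀ b, m.fst b = n.fst b) : m = n := by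
  refine DoubleCentralizer.ext _ _ _ _ (Prod.ext (ContinuousLinearMap.ext h) ?_)
  refine ContinuousLinearMap.ext fun b => ?_
  rw [← sub_eq_zero, ← CStarRing.mul_star_self_eq_zero_iff, sub_mul, ← star_mul_fst,
    ← star_mul_fst, h, sub_self]

/-- The multiplier given by an adjointable map of `B`. -/
noncomputable def toMultiplier {t s : B → B} (h : IsAdjoint B t s) : 𝓜(ℂ, B) where
  fst := h.toCLM
  snd :=
    { toFun := fun c => star (s (star c))
      map_add' := fun c d => by rw [star_add, h.symm.map_add, star_add]
      map_smul' := fun z c => by rw [star_smul, h.symm.map_smul, star_smul, star_star]; rfl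
      cont := continuous_star.comp (h.symm.toCLM.continuous.comp continuous_star) }
  central x y := by
    have := h y (star x)
    simpa using this.symm

@[simp] lemma toMultiplier_fst {t s : B → B} (h : IsAdjoint B t s) (b : B) :
    (toMultiplier h).fst b = t b := rfl

@[simp] lemma toMultiplier_snd {t s : B → B} (h : IsAdjoint B t s) (b : B) :
    (toMultiplier h).snd b = star (s (star b)) := rfl

lemma isAdjoint_multiplier (m : 𝓜(ℂ, B)) : IsAdjoint B m.fst (star m).fst := fun v w => by
  rw [ip_self_module, ip_self_module, DoubleCentralizer.star_fst, star_star, star_mul_fst]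

lemma tendsto_strict_iff {ι : Type*} {l : Filter ι} {f : ι → 𝓜(ℂ, B)} {m : 𝓜(ℂ, B)} :
    Tendsto f l (@nhds _ (strictTopology B) m) ↔
      (∀ b, Tendsto (fun i => (f i).fst b) l (𝓝 (m.fst b))) ∧
      ∀ b, Tendsto (fun i => (f i).snd b) l (𝓝 (m.snd b)) := by
  rw [nhds_induced, tendsto_comap_iff, tendsto_pi_nhds, ← forall_and]
  refine forall_congr' fun b => ?_
  rw [nhds_prod_eq, tendsto_prod_iff']
  rfl

lemma tendsto_strict_unique {ι : Type*} {l : Filter ι} [l.NeBot] {f : ι → 𝓜(ℂ, B)}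
    {m n : 𝓜(ℂ, B)} (hm : Tendsto f l (@nhds _ (strictTopology B) m))
    (hn : Tendsto f l (@nhds _ (strictTopology B) n)) : m = n :=
  multiplier_ext fun b =>
    tendsto_nhds_unique ((tendsto_strict_iff.1 hm).1 b) ((tendsto_strict_iff.1 hn).1 b)

variable {ρ σ : A →ₗ[ℂ] 𝓜(ℂ, B)}

lemma IsStrict.tendsto (hρ : IsStrict ρ) {ι : Type*} {l : Filter ι} {f : ι → A} {x : A} {r : ℝ}
    (hf : ∀ᶠ i in l, ‖f i‖ ≤ r) (hx : ‖x‖ ≤ r) (h1 : ∀ a, Tendsto (fun i => f i * a) l (𝓝 (x * a)))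
    (h2 : ∀ a, Tendsto (fun i => a * f i) l (𝓝 (a * x))) :
    Tendsto (fun i => ρ (f i)) l (@nhds _ (strictTopology B) (ρ x)) := by
  have h3 := hρ r x (mem_closedBall_zero_iff.2 hx)
  refine Tendsto.comp h3 (tendsto_inf.2 ⟨?_, tendsto_principal.2 ?_⟩)
  · rw [@nhds_induced _ _ (strictTopology A), tendsto_comap_iff]
    exact tendsto_strict_iff.2 ⟨h1, h2⟩
  · filter_upwards [hf] with i hi using mem_closedBall_zero_iff.2 hi

lemma isStrict_of_tendsto (h : ∀ (r : ℝ) (x : A) (l : Filter A), (∀ᶠ y in l, ‖y‖ ≤ r) → ‖x‖ ≤ r →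
    (∀ a, Tendsto (fun y => y * a) l (𝓝 (x * a))) → (∀ a, Tendsto (fun y => a * y) l (𝓝 (a * x))) →
    Tendsto ρ l (@nhds _ (strictTopology B) (ρ x))) : IsStrict ρ := by
  intro r x hx
  have h3 : Tendsto (fun y : A => (y : 𝓜(ℂ, A)))
      (@nhdsWithin _ ((strictTopology A).induced (fun a : A => (a : 𝓜(ℂ, A)))) x
        (Metric.closedBall 0 r)) (@nhds _ (strictTopology A) (x : 𝓜(ℂ, A))) := by
    refine Tendsto.mono_left ?_ inf_le_left
    rw [@nhds_induced _ _ (strictTopology A)]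
    exact tendsto_comap
  rw [tendsto_strict_iff] at h3
  refine h r x _ ?_ (mem_closedBall_zero_iff.1 hx) h3.1 h3.2
  exact Filter.mem_of_superset (mem_inf_of_right (mem_principal_self _))
    fun y hy => mem_closedBall_zero_iff.1 hy

/-- A norm convergent net is eventually bounded, and it converges strictly. Strict maps are thus
continuous from the norm to the strict topology. -/
lemma IsStrict.tendsto_of_tendsto (hρ : IsStrict ρ) {ι : Type*} {l : Filter ι} {f : ι → A} {x : A}
    (hf : Tendsto f l (𝓝 x)) :
    Tendsto (fun i => ρ (f i)) l (@nhds _ (strictTopology B) (ρ x)) := by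
  refine hρ.tendsto (r := ‖x‖ + 1) ?_ (by linarith) (fun a => hf.mul_const a)
    (fun a => hf.const_mul a)
  filter_upwards [hf.norm.eventually (eventually_le_nhds (lt_add_one ‖x‖))] with i hi using hi

lemma IsStrict.continuous_fst (hρ : IsStrict ρ) (b : B) : Continuous fun x => (ρ x).fst b :=
  continuous_iff_continuousAt.2 fun _ =>
    (tendsto_strict_iff.1 (hρ.tendsto_of_tendsto tendsto_id)).1 b

/-- Evaluation of a strict map at a vector of `B`, as a bounded linear map. -/
noncomputable def IsStrict.evalCLM (hρ : IsStrict ρ) (b : B) : A →L[ℂ] B where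
  toFun x := (ρ x).fst b
  map_add' x y := by simp
  map_smul' z x := by simp
  cont := hρ.continuous_fst b

@[simp] lemma IsStrict.evalCLM_apply (hρ : IsStrict ρ) (b : B) (x : A) :
    hρ.evalCLM b x = (ρ x).fst b := rfl

lemma IsCP.star_mul_nonneg (hρ : IsCP ρ) {x : A} (hx : 0 ≤ x) (b : B) :
    0 ≤ star b * (ρ x).fst b := by
  obtain ⟨a, rfl⟩ := CStarAlgebra.nonneg_iff_eq_star_mul_self.1 hx
  simpa using hρ 1 (fun _ => a) (fun _ => b)

lemma isCP_zero : IsCP (0 : A →ₗ[ℂ] 𝓜(ℂ, B)) := fun n a b => by simp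

lemma IsCP.add (hρ : IsCP ρ) (hσ : IsCP σ) : IsCP (ρ + σ) := fun n a b => by
  simpa [mul_add, Finset.sum_add_distrib] using add_nonneg (hρ n a b) (hσ n a b)

lemma IsCP.smul (hρ : IsCP ρ) {r : ℝ} (hr : 0 ≤ r) : IsCP ((r : ℂ) • ρ) := fun n a b => by
  have := smul_nonneg hr (hρ n a b)
  simpa [Finset.smul_sum, mul_smul_comm] using this

lemma IsStrict.add (hρ : IsStrict ρ) (hσ : IsStrict σ) : IsStrict (ρ + σ) :=
  isStrict_of_tendsto fun r x l hl hx h1 h2 => by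
    have h3 := tendsto_strict_iff.1 (hρ.tendsto (f := id) hl hx h1 h2)
    have h4 := tendsto_strict_iff.1 (hσ.tendsto (f := id) hl hx h1 h2)
    exact tendsto_strict_iff.2 ⟨fun b => (h3.1 b).add (h4.1 b), fun b => (h3.2 b).add (h4.2 b)⟩

lemma IsStrict.smul (hρ : IsStrict ρ) (z : ℂ) : IsStrict (z • ρ) :=
  isStrict_of_tendsto fun r x l hl hx h1 h2 => by
    have h3 := tendsto_strict_iff.1 (hρ.tendsto (f := id) hl hx h1 h2)
    exact tendsto_strict_iff.2
      ⟨fun b => (h3.1 b).const_smul z, fun b => (h3.2 b).const_smul z⟩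

lemma isStrict_zero : IsStrict (0 : A →ₗ[ℂ] 𝓜(ℂ, B)) :=
  isStrict_of_tendsto fun _ _ _ _ _ _ _ =>
    tendsto_strict_iff.2 ⟨fun _ => tendsto_const_nhds, fun _ => tendsto_const_nhds⟩

end Multiplier

/-! ### A Cauchy criterion by squared norms. -/

section Cauchy

/-- Squared norms are what the values of the maps ρ control. -/
lemma cauchy_map_of_tendsto_norm_sq {ι E : Type*} [NormedAddCommGroup E] {l : Filter ι} [l.NeBot]
    {f : ι → E} (h : Tendsto (fun p : ι × ι => ‖f p.1 - f p.2‖ ^ 2) (l ×ˢ l) (𝓝 0)) :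
    Cauchy (map f l) := by
  refine cauchy_map_iff.2 ⟨‹_›, ?_⟩
  rw [Metric.uniformity_eq_comap_nhds_zero, tendsto_comap_iff]
  refine ((Real.continuous_sqrt.tendsto 0).comp h).congr' (Eventually.of_forall fun p => ?_) |>.trans
    (by simp)
  simp [Real.sqrt_sq, dist_eq_norm]

end Cauchy

/-! ### Multipliers acting on products. -/

section Multiplier

variable {A : Type*} [NonUnitalCStarAlgebra A]

lemma multiplier_fst_mul (w : 𝓜(ℂ, A)) (a b : A) : w.fst (a * b) = w.fst a * b := by
  rw [← sub_eq_zero, ← CStarRing.star_mul_self_eq_zero_iff, mul_sub, ← mul_assoc, ← w.central,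
    ← w.central, mul_assoc, sub_self]

lemma multiplier_snd_mul (w : 𝓜(ℂ, A)) (a b : A) : w.snd (a * b) = a * w.snd b := by
  rw [← sub_eq_zero, ← CStarRing.mul_star_self_eq_zero_iff, sub_mul, mul_assoc, w.central,
    w.central, mul_assoc, sub_self]

/-- `(a w)* (b w) = w* (a* b) w` for a multiplier `w`. -/
lemma star_snd_mul_snd (w : 𝓜(ℂ, A)) (a b : A) :
    star (w.snd a) * w.snd b = w.snd ((star w).fst (star a * b)) := by
  rw [multiplier_fst_mul, multiplier_snd_mul, DoubleCentralizer.star_fst, star_star]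

end Multiplier

/-! ### Truncating nets: adjointability of Λ(a) and membership in N. -/

section Truncation

variable {A B E : Type*} [NonUnitalCStarAlgebra A] [PartialOrder A] [StarOrderedRing A]
  [NonUnitalCStarAlgebra B] [PartialOrder B] [StarOrderedRing B]
  [NormedAddCommGroup E] [NormedSpace ℂ E] [CompleteSpace E]
  [SMul Bᵐᵒᵖ E] [CStarModule Bᵐᵒᵖ E]

variable {Λ : A →ₗ.[ℂ] (B →ₗ[ℂ] E)} {I : Type*} [Preorder I] {u : I → 𝓜(ℂ, A)}
  {S : I → Adjointable B E} {ρ : I → A →ₗ[ℂ] 𝓜(ℂ, B)}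

variable (Λ u S ρ) in
/-- The data of a truncating net for `Λ`: the operators `S i` implement the multiplication by
`u i` from the right, and the maps `ρ i` are those defined by `S i`. -/
structure IsTruncation : Prop where
  mem : ∀ (i : I) (a : Λ.domain), (u i).snd (a : A) ∈ Λ.domain
  apply : ∀ i (a : Λ.domain) b, (S i).toCLM (Λ a b) = Λ ⟨(u i).snd (a : A), mem i a⟩ b
  norm_u_le : ∀ i, ‖u i‖ ≤ 1
  norm_S_le : ∀ i, ‖S i‖ ≤ 1
  isCP : ∀ i, IsCP (ρ i)
  isStrict : ∀ i, IsStrict (ρ i)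
  gram : ∀ i (a₁ a₂ : Λ.domain) (b₁ b₂ : B), star b₂ * (ρ i (star (a₂ : A) * a₁)).fst b₁ =
    ip B ((S i).toCLM (Λ a₁ b₁)) ((S i).toCLM (Λ a₂ b₂))
  tendsto_u_fst : ∀ a, Tendsto (fun i => (u i).fst a) atTop (𝓝 a)
  tendsto_u_snd : ∀ a, Tendsto (fun i => (u i).snd a) atTop (𝓝 a)
  tendsto_S : ∀ v, Tendsto (fun i => (S i).toCLM v) atTop (𝓝 v)

lemma IsTruncatingNet.exists_isTruncation (h : IsTruncatingNet Λ u) :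
    ∃ (S : I → Adjointable B E) (ρ : I → A →ₗ[ℂ] 𝓜(ℂ, B)), IsTruncation Λ u S ρ := by
  obtain ⟨hu, S, hS, hn, hρ, hu1, hS1⟩ := h
  choose ρ hρ _ using hρ
  choose T hT using fun i => Adjointable.exists_toCLM_eq (hS i).1
  rw [tendsto_strict_iff] at hu1
  refine ⟨T, ρ, hu, fun i a b => ?_, fun i => (hn i).1, fun i => ?_, fun i => (hρ i).1,
    fun i => (hρ i).2.1, fun i a₁ a₂ b₁ b₂ => ?_, hu1.1, hu1.2, fun v => ?_⟩
  · rw [hT, (hS i).2.1]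
  · rw [Adjointable.norm_eq, hT]; exact (hn i).2
  · rw [hT]; exact (hρ i).2.2 a₁ a₂ b₁ b₂
  · simp only [hT]; exact hS1 v

namespace IsTruncation

variable (h : IsTruncation Λ u S ρ)
include h

lemma norm_S_apply_le (i : I) (v : E) : ‖(S i).toCLM v‖ ≤ ‖v‖ :=
  (ContinuousLinearMap.le_opNorm _ _).trans
    (mul_le_of_le_one_left (norm_nonneg v) (h.norm_S_le i))

lemma norm_snd_le (i : I) (a : A) : ‖(u i).snd a‖ ≤ ‖a‖ :=
  (ContinuousLinearMap.le_opNorm _ _).trans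
    (mul_le_of_le_one_left (norm_nonneg a) (by rw [DoubleCentralizer.norm_snd]; exact h.norm_u_le i))

/-- Strong convergence of S_i says nothing directly about S_i*. With T = S_i* S_i one has ⟨Tv, Tv⟩ ≤
⟨S_i v, S_i v⟩ = ⟨Tv, v⟩, so ⟨v − Tv, v − Tv⟩ ≤ ⟨v, v⟩ − ⟨S_i v, S_i v⟩ → 0. -/
lemma tendsto_star_mul_S (v : E) : Tendsto (fun i => (star (S i) * S i).toCLM v) atTop (𝓝 v) := by
  rw [tendsto_iff_norm_sub_tendsto_zero]
  have h1 : Tendsto (fun i => ip B v v - ip B ((S i).toCLM v) ((S i).toCLM v)) atTop (𝓝 0) := by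
    have := (tendsto_const_nhds (x := ip B v v)).sub (tendsto_ip (h.tendsto_S v) (h.tendsto_S v))
    simpa using this
  have h2 : Tendsto (fun i => √‖ip B v v - ip B ((S i).toCLM v) ((S i).toCLM v)‖) atTop (𝓝 0) := by
    have := (Real.continuous_sqrt.tendsto _).comp h1.norm
    simpa [Function.comp_def] using this
  refine squeeze_zero (fun _ => norm_nonneg _) (fun i => ?_) h2
  refine Real.le_sqrt_of_sq_le ?_
  rw [← norm_ip_self (B := B)]
  refine CStarAlgebra.norm_le_norm_of_nonneg_of_le (ip_self_nonneg _) ?_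
  set T := star (S i) * S i with hT
  have h3 : ip B (T.toCLM v) (T.toCLM v) ≤ ip B ((S i).toCLM v) ((S i).toCLM v) := by
    have : ‖star (S i)‖ ≤ 1 := by rw [norm_star]; exact h.norm_S_le i
    exact Adjointable.ip_apply_self_le_of_norm_le_one this _
  have h4 : ip B (T.toCLM v) v = ip B ((S i).toCLM v) ((S i).toCLM v) :=
    Adjointable.ip_star_mul_self _ _
  have h5 : ip B v (T.toCLM v) = ip B ((S i).toCLM v) ((S i).toCLM v) := by
    rw [← star_ip, h4, star_ip]
  simp only [ip_sub_left, ip_sub_right, h4, h5]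
  rw [← sub_nonneg] at h3 ⊢
  convert h3 using 1
  abel

/-- Transfers norm continuity of ρ_i on A to estimates in E. -/
lemma norm_sq_S_apply (i : I) (a : Λ.domain) (b : B) :
    ‖(S i).toCLM (Λ a b)‖ ^ 2 = ‖star b * (ρ i (star (a : A) * a)).fst b‖ := by
  rw [h.gram, norm_ip_self]

variable [IsDirectedOrder I] [Nonempty I]

/-- Each S_i Λ(a) is bounded by means of ρ_i(a* a). These maps are pointwise bounded since ‖S_i‖ ≤ 1
and converge pointwise to Λ(a), so uniform boundedness applies. -/
lemma exists_norm_le (a : Λ.domain) : ∃ C, ∀ b, ‖Λ a b‖ ≤ C * ‖b‖ := by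
  have h1 : ∀ i b, ‖(S i).toCLM (Λ a b)‖ ≤ √‖(ρ i (star (a : A) * a)).fst‖ * ‖b‖ := by
    intro i b
    rw [← Real.sqrt_sq (norm_nonneg b), ← Real.sqrt_mul (norm_nonneg _)]
    refine Real.le_sqrt_of_sq_le ?_
    rw [h.norm_sq_S_apply]
    calc _ ≤ ‖star b‖ * ‖(ρ i (star (a : A) * a)).fst b‖ := norm_mul_le _ _
      _ ≤ ‖b‖ * (‖(ρ i (star (a : A) * a)).fst‖ * ‖b‖) := by
        rw [norm_star]; gcongr; exact ContinuousLinearMap.le_opNorm _ _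
      _ = _ := by ring
  let g : I → B →L[ℂ] E := fun i => ((S i).toCLM.toLinearMap ∘ₗ Λ a).mkContinuous _ (h1 i)
  obtain ⟨C, hC⟩ := banach_steinhaus (g := g) fun b => ⟨‖Λ a b‖, fun i => h.norm_S_apply_le i _⟩
  refine ⟨C, fun b => le_of_tendsto (h.tendsto_S (Λ a b)).norm (Eventually.of_forall fun i => ?_)⟩
  exact (g i).le_of_opNorm_le (hC i) b

/-- The maps `Λ(a)` are adjointable. -/
lemma isAdjointable (hr : HasDenseRange Λ) (a : Λ.domain) : IsAdjointable B (Λ a) := by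
  obtain ⟨C, hC⟩ := h.exists_norm_le a
  refine isAdjointable_of_dense ((Λ a).mkContinuous C hC)
    (D := {v | ∃ (i : I) (a : Λ.domain) (b : B), v = (star (S i) * S i).toCLM (Λ a b)}) ?_ ?_
  · set D := {v | ∃ (i : I) (a : Λ.domain) (b : B), v = (star (S i) * S i).toCLM (Λ a b)}
    rw [Submodule.dense_iff_topologicalClosure_eq_top, eq_top_iff,
      ← (Submodule.dense_iff_topologicalClosure_eq_top.1 hr)]
    refine Submodule.topologicalClosure_minimal _ (Submodule.span_le.2 ?_)
      (Submodule.isClosed_topologicalClosure _)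
    rintro _ ⟨a, b, rfl⟩
    exact mem_closure_of_tendsto (h.tendsto_star_mul_S (Λ a b))
      (Eventually.of_forall fun i => Submodule.subset_span ⟨i, a, b, rfl⟩)
  · rintro _ ⟨i, a', b', rfl⟩
    -- ⟨Λ(a)b, S_i* S_i Λ(a')b'⟩ = b'* ρ_i(a'* a) b, which dictates the value of the adjoint.
    refine ⟨(star (ρ i (star (a' : A) * a))).fst b', fun b => ?_⟩
    rw [← isAdjoint_multiplier]
    refine Eq.trans ?_ (h.gram i a a' b b').symm
    exact (Adjointable.isAdjoint (S i) _ _).symm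

end IsTruncation

/-- A closed map is defined at the limit of a net along which its values are Cauchy. -/
lemma IsNormStronglyClosed.mem_of_cauchy (hc : IsNormStronglyClosed Λ) {ι : Type*} {l : Filter ι}
    [l.NeBot] {f : ι → Λ.domain} {a : A} (hf : Tendsto (fun i => (f i : A)) l (𝓝 a))
    (hb : ∀ b, Cauchy (map (fun i => Λ (f i) b) l)) :
    ∃ h : a ∈ Λ.domain, ∀ b, Tendsto (fun i => Λ (f i) b) l (𝓝 (Λ ⟨a, h⟩ b)) := by
  choose t ht using fun b => CompleteSpace.complete (hb b)
  replace ht : ∀ b, Tendsto (fun i => Λ (f i) b) l (𝓝 (t b)) := ht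
  let t' : B →ₗ[ℂ] E :=
    { toFun := t
      map_add' := fun b c => tendsto_nhds_unique (ht (b + c)) <| by
        simpa using (ht b).add (ht c)
      map_smul' := fun z c => tendsto_nhds_unique (ht (z • c)) <| by
        simpa using (ht c).const_smul z }
  obtain ⟨h, h'⟩ := hc (map f l) a t' (tendsto_map'_iff.2 hf) fun b => tendsto_map'_iff.2 (ht b)
  refine ⟨h, fun b => ?_⟩
  rw [h']
  exact ht b

namespace IsTruncation

variable (h : IsTruncation Λ u S ρ)
include h

/-- Approximate a by x ∈ N. The vectors Λ(x u_i)b = S_i Λ(x)b are Cauchy because ρ_i is norm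
continuous, and Λ is closed. -/
lemma exists_tendsto_snd (hd : Dense (Λ.domain : Set A)) (hc : IsNormStronglyClosed Λ)
    (i : I) (a : A) : ∃ ha : (u i).snd a ∈ Λ.domain, ∀ b,
      Tendsto (fun x : Λ.domain => Λ ⟨(u i).snd (x : A), h.mem i x⟩ b)
        (comap Subtype.val (𝓝 a)) (𝓝 (Λ ⟨(u i).snd a, ha⟩ b)) := by
  have : (comap (Subtype.val : Λ.domain → A) (𝓝 a)).NeBot := mem_closure_iff_comap_neBot.1 (hd a)
  refine hc.mem_of_cauchy (f := fun x : Λ.domain => ⟨(u i).snd (x : A), h.mem i x⟩)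
    (((u i).snd.continuous.tendsto a).comp tendsto_comap) fun b => cauchy_map_of_tendsto_norm_sq ?_
  have h1 : ∀ p : Λ.domain × Λ.domain, ‖Λ ⟨(u i).snd (p.1 : A), h.mem i p.1⟩ b -
      Λ ⟨(u i).snd (p.2 : A), h.mem i p.2⟩ b‖ ^ 2 =
      ‖star b * (ρ i (star (p.1 - p.2 : A) * (p.1 - p.2 : A))).fst b‖ := fun p => by
    rw [← h.apply, ← h.apply, ← map_sub, ← LinearMap.sub_apply, ← LinearPMap.map_sub,
      h.norm_sq_S_apply]
    rfl
  simp only [h1]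
  have h2 : Tendsto (fun p : Λ.domain × Λ.domain => (p.1 - p.2 : A))
      (comap Subtype.val (𝓝 a) ×ˢ comap Subtype.val (𝓝 a)) (𝓝 (a - a)) :=
    (tendsto_comap.comp tendsto_fst).sub (tendsto_comap.comp tendsto_snd)
  rw [sub_self] at h2
  have h3 := (((h.isStrict i).continuous_fst b).tendsto _).comp (h2.star.mul h2)
  simpa using (h3.const_mul (star b)).norm

/-- `a uᵢ` belongs to the domain of `Λ` for every `a`. -/
lemma snd_mem (hd : Dense (Λ.domain : Set A)) (hc : IsNormStronglyClosed Λ) (i : I) (a : A) :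
    (u i).snd a ∈ Λ.domain := (h.exists_tendsto_snd hd hc i a).1

/-- Extends the defining relation of ρ_i from N to A by density: it is the formula ρ_i(x) = φ(u_i* x
u_i). -/
lemma gram_snd (hd : Dense (Λ.domain : Set A)) (hc : IsNormStronglyClosed Λ) (i : I)
    (a₁ a₂ : A) (b₁ b₂ : B) : star b₂ * (ρ i (star a₂ * a₁)).fst b₁ = ip B (Λ ⟨(u i).snd a₁, h.snd_mem hd hc i a₁⟩ b₁)
      (Λ ⟨(u i).snd a₂, h.snd_mem hd hc i a₂⟩ b₂) := by
  have n1 : (comap (Subtype.val : Λ.domain → A) (𝓝 a₁)).NeBot :=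
    mem_closure_iff_comap_neBot.1 (hd a₁)
  have n2 : (comap (Subtype.val : Λ.domain → A) (𝓝 a₂)).NeBot :=
    mem_closure_iff_comap_neBot.1 (hd a₂)
  have t1 := ((h.exists_tendsto_snd hd hc i a₁).2 b₁).comp
    (tendsto_fst (g := comap (Subtype.val : Λ.domain → A) (𝓝 a₂)))
  have t2 := ((h.exists_tendsto_snd hd hc i a₂).2 b₂).comp
    (tendsto_snd (f := comap (Subtype.val : Λ.domain → A) (𝓝 a₁)))
  have t3 := tendsto_ip (B := B) t1 t2
  refine tendsto_nhds_unique ?_ t3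
  have t4 : Tendsto (fun p : Λ.domain × Λ.domain => star (p.2 : A) * (p.1 : A))
      (comap Subtype.val (𝓝 a₁) ×ˢ comap Subtype.val (𝓝 a₂)) (𝓝 (star a₂ * a₁)) :=
    (tendsto_comap.comp tendsto_snd).star.mul (tendsto_comap.comp tendsto_fst)
  refine (((((h.isStrict i).continuous_fst b₁).tendsto _).comp t4).const_mul (star b₂)).congr
    fun p => ?_
  simp only [Function.comp_apply]
  rw [h.gram, h.apply, h.apply]

variable [IsDirectedOrder I] [Nonempty I]

/-- If `a* a` is dominated by a sum of elements `c* c` with `c` in the domain of `Λ`, then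
`a` is in the domain of `Λ`. -/
lemma mem_of_star_mul_le (hd : Dense (Λ.domain : Set A)) (hc : IsNormStronglyClosed Λ) {ι : Type*} [Fintype ι] {a : A} (c : ι → Λ.domain)
    (hac : star a * a ≤ ∑ k, star (c k : A) * (c k : A)) : a ∈ Λ.domain := by
  let T : I → A → Λ.domain := fun i x => ⟨(u i).snd x, h.snd_mem hd hc i x⟩
  refine (hc.mem_of_cauchy (f := fun i => T i a) (h.tendsto_u_snd a) fun b =>
    cauchy_map_of_tendsto_norm_sq ?_).1
  -- Writing the difference as z* z keeps the inequality under x ↦ w* x w with w = u_i − u_j, since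
  -- w* z* z w = (zw)*(zw).
  obtain ⟨z, hz⟩ := CStarAlgebra.nonneg_iff_eq_star_mul_self.1 (sub_nonneg.2 hac)
  have key : ∀ i j, ‖Λ (T i a) b - Λ (T j a) b‖ ^ 2 ≤
      ∑ k, ‖(S i).toCLM (Λ (c k) b) - (S j).toCLM (Λ (c k) b)‖ ^ 2 := by
    intro i j
    have hT : ∀ x, ((T i x - T j x : Λ.domain) : A) = (u i - u j).snd x := fun x => rfl
    have h1 : star (T i a - T j a : A) * (T i a - T j a : A) ≤
        ∑ k, star (T i (c k) - T j (c k) : A) * (T i (c k) - T j (c k) : A) := by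
      have h2 := congr_arg (fun x => (u i - u j).snd ((star (u i - u j)).fst x)) hz
      simp only [map_sub, map_sum, ← star_snd_mul_snd] at h2
      rw [← sub_nonneg]
      refine (star_mul_self_nonneg ((u i - u j).snd z)).trans_eq (h2.symm.trans ?_)
      rfl
    -- The inequality in A is carried to E by the completely positive ρ_m; the limit in m then
    -- removes S_m from the left-hand side.
    have h2 : ∀ m, ‖(S m).toCLM (Λ (T i a - T j a) b)‖ ^ 2 ≤
        ∑ k, ‖Λ (T i (c k) - T j (c k)) b‖ ^ 2 := by
      intro m
      rw [h.norm_sq_S_apply]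
      have h3 := (h.isCP m).star_mul_nonneg (sub_nonneg.2 h1) b
      rw [map_sub, DoubleCentralizer.sub_fst, sub_apply, mul_sub, sub_nonneg] at h3
      have h4 := (h.isCP m).star_mul_nonneg (star_mul_self_nonneg (T i a - T j a : A)) b
      refine (CStarAlgebra.norm_le_norm_of_nonneg_of_le h4 h3).trans ?_
      have h5 : star b * (ρ m (∑ k, star (T i (c k) - T j (c k) : A) *
          (T i (c k) - T j (c k) : A))).fst b = ∑ k, star b * (ρ m (star (T i (c k) - T j (c k) : A) *
          (T i (c k) - T j (c k) : A))).fst b := by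
        rw [← (h.isStrict m).evalCLM_apply, map_sum, Finset.mul_sum]
        rfl
      rw [h5]
      refine (norm_sum_le _ _).trans (Finset.sum_le_sum fun k _ => ?_)
      refine (h.norm_sq_S_apply m (T i (c k) - T j (c k)) b).symm.trans_le ?_
      gcongr
      exact h.norm_S_apply_le m _
    have h3 := le_of_tendsto (((h.tendsto_S (Λ (T i a - T j a) b)).norm).pow 2)
      (Eventually.of_forall h2)
    simp only [LinearPMap.map_sub, LinearMap.sub_apply] at h3
    refine h3.trans_eq (Finset.sum_congr rfl fun k _ => ?_)
    rw [h.apply, h.apply]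
  refine squeeze_zero (fun _ => by positivity) (fun p => key p.1 p.2) ?_
  have h0 : (0 : ℝ) = ∑ k : ι, ‖Λ (c k) b - Λ (c k) b‖ ^ 2 := by simp
  rw [h0]
  refine tendsto_finsetSum _ fun k _ => ?_
  exact ((((h.tendsto_S _).comp tendsto_fst).sub ((h.tendsto_S _).comp tendsto_snd)).norm).pow 2

end IsTruncation

end Truncation

/-! ### Construction of φ and its weight properties. -/

section Weight

variable {A B E : Type*} [NonUnitalCStarAlgebra A] [PartialOrder A] [StarOrderedRing A]
  [NonUnitalCStarAlgebra B] [PartialOrder B] [StarOrderedRing B]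
  [NormedAddCommGroup E] [NormedSpace ℂ E] [CompleteSpace E]
  [SMul Bᵐᵒᵖ E] [CStarModule Bᵐᵒᵖ E]

lemma tendsto_strict_add {ι : Type*} {l : Filter ι} {f g : ι → 𝓜(ℂ, B)} {m n : 𝓜(ℂ, B)}
    (hf : Tendsto f l (@nhds _ (strictTopology B) m))
    (hg : Tendsto g l (@nhds _ (strictTopology B) n)) :
    Tendsto (fun i => f i + g i) l (@nhds _ (strictTopology B) (m + n)) := by
  rw [tendsto_strict_iff] at *
  exact ⟨fun b => (hf.1 b).add (hg.1 b), fun b => (hf.2 b).add (hg.2 b)⟩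

lemma tendsto_strict_smul {ι : Type*} {l : Filter ι} {f : ι → 𝓜(ℂ, B)} {m : 𝓜(ℂ, B)} (z : ℂ)
    (hf : Tendsto f l (@nhds _ (strictTopology B) m)) :
    Tendsto (fun i => z • f i) l (@nhds _ (strictTopology B) (z • m)) := by
  rw [tendsto_strict_iff] at *
  exact ⟨fun b => (hf.1 b).const_smul z, fun b => (hf.2 b).const_smul z⟩

variable {Λ : A →ₗ.[ℂ] (B →ₗ[ℂ] E)}

/-- The multiplier `Λ(b)* T Λ(a)`. -/
noncomputable def gramMul (hA : ∀ a, IsAdjointable B (Λ a)) (T : Adjointable B E)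
    (b a : Λ.domain) : 𝓜(ℂ, B) :=
  toMultiplier (t := fun c => (hA b).choose (T.toCLM (Λ a c)))
    (s := fun c => (hA a).choose ((star T).toCLM (Λ b c)))
    (fun v w => ((hA b).choose_spec.symm _ w).trans
      ((T.isAdjoint _ _).trans ((hA a).choose_spec v _)))

variable (hA : ∀ a, IsAdjointable B (Λ a))

lemma star_mul_gramMul (T : Adjointable B E) (b a : Λ.domain) (c d : B) :
    star d * (gramMul hA T b a).fst c = ip B (T.toCLM (Λ a c)) (Λ b d) :=
  (hA b).choose_spec.symm _ _

lemma eq_gramMul {T : Adjointable B E} {b a : Λ.domain} {m : 𝓜(ℂ, B)}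
    (h : ∀ c d, star d * m.fst c = ip B (T.toCLM (Λ a c)) (Λ b d)) : m = gramMul hA T b a :=
  multiplier_ext fun c => eq_of_forall_ip_left (B := B) fun d => by
    rw [ip_self_module, ip_self_module, h, star_mul_gramMul]

/-- The two halves of strict convergence use strong convergence of the operators and of their
adjoints respectively. -/
lemma tendsto_gramMul {κ : Type*} {l : Filter κ} {T : κ → Adjointable B E} {T₀ : Adjointable B E}
    (h1 : ∀ v, Tendsto (fun k => (T k).toCLM v) l (𝓝 (T₀.toCLM v)))
    (h2 : ∀ v, Tendsto (fun k => (star (T k)).toCLM v) l (𝓝 ((star T₀).toCLM v)))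
    (b a : Λ.domain) : Tendsto (fun k => gramMul hA (T k) b a) l
      (@nhds _ (strictTopology B) (gramMul hA T₀ b a)) := by
  refine tendsto_strict_iff.2 ⟨fun c => ?_, fun c => ?_⟩
  · exact ((hA b).choose_spec.symm.toCLM.continuous.tendsto _).comp (h1 _)
  · exact (((hA a).choose_spec.symm.toCLM.continuous.tendsto _).comp (h2 _)).star

variable (Λ) in
/-- The span of the products `b* a` with `a` and `b` in the domain of `Λ`. -/
def gramDomain : Submodule ℂ A :=
  Submodule.span ℂ {x | ∃ a ∈ Λ.domain, ∃ b ∈ Λ.domain, x = star b * a}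

lemma star_mul_mem_gramDomain {a b : A} (ha : a ∈ Λ.domain) (hb : b ∈ Λ.domain) :
    star b * a ∈ gramDomain Λ := Submodule.subset_span ⟨a, ha, b, hb, rfl⟩

lemma exists_eq_sum_of_mem_gramDomain {x : A} (hx : x ∈ gramDomain Λ) :
    ∃ (n : ℕ) (a b : Fin n → Λ.domain), x = ∑ j, star (b j : A) * (a j : A) := by
  induction hx using Submodule.span_induction with
  | mem x hx =>
    obtain ⟨a, ha, b, hb, rfl⟩ := hx
    exact ⟨1, fun _ => ⟨a, ha⟩, fun _ => ⟨b, hb⟩, by simp⟩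
  | zero => exact ⟨0, Fin.elim0, Fin.elim0, by simp⟩
  | add x y _ _ hx hy =>
    obtain ⟨n, a, b, rfl⟩ := hx
    obtain ⟨m, a', b', rfl⟩ := hy
    exact ⟨n + m, Fin.append a a', Fin.append b b', by simp [Fin.sum_univ_add]⟩
  | smul z x _ hx =>
    obtain ⟨n, a, b, rfl⟩ := hx
    exact ⟨n, fun j => z • a j, b, by simp [Finset.smul_sum, mul_smul_comm]⟩

/-- Positive elements of the span of the products are dominated by sums of squares. -/
lemma exists_le_sum_of_mem_gramDomain {x : A} (hx : x ∈ gramDomain Λ) (h0 : 0 ≤ x) :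
    ∃ (n : ℕ) (c : Fin n ⊕ Fin n → Λ.domain), x ≤ ∑ k, star (c k : A) * (c k : A) := by
  obtain ⟨n, a, b, rfl⟩ := exists_eq_sum_of_mem_gramDomain hx
  refine ⟨n, Sum.elim a b, ?_⟩
  set x := ∑ j, star (b j : A) * (a j : A) with hxd
  -- Adding x* = x ≥ 0 symmetrizes the terms to b* a + a* b, which is at most a* a + b* b because (a
  -- − b)*(a − b) ≥ 0.
  have h1 : x ≤ x + star x := by
    rw [h0.isSelfAdjoint.star_eq]
    exact le_add_of_nonneg_left h0
  refine h1.trans ?_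
  rw [Fintype.sum_sum_type, hxd, star_sum, ← Finset.sum_add_distrib, ← Finset.sum_add_distrib]
  refine Finset.sum_le_sum fun j _ => ?_
  have h2 := star_mul_self_nonneg (a j - b j : A)
  rw [← sub_nonneg]
  refine h2.trans_eq ?_
  simp only [Sum.elim_inl, Sum.elim_inr, star_sub, star_mul, star_star, mul_sub, sub_mul]
  abel

/-- A product `b* a` is a combination of squares. -/
lemma gramDomain_eq_span_squares :
    gramDomain Λ = Submodule.span ℂ {x | ∃ a ∈ Λ.domain, x = star a * a} := by
  refine le_antisymm (Submodule.span_le.2 ?_) (Submodule.span_le.2 ?_)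
  · rintro _ ⟨a, ha, b, hb, rfl⟩
    set D := Submodule.span ℂ {x | ∃ a ∈ Λ.domain, x = star a * a}
    have hD : ∀ c ∈ Λ.domain, star c * c ∈ D := fun c hc => Submodule.subset_span ⟨c, hc, rfl⟩
    have h1 := hD _ (add_mem ha hb)
    have h2 := hD _ (add_mem ha (Λ.domain.smul_mem Complex.I hb))
    -- Two-term polarization: the brackets are a* b + b* a and i(a* b − b* a).
    have h3 : star b * a = (2⁻¹ : ℂ) • ((star (a + b) * (a + b) - star a * a - star b * b) +
        Complex.I • (star (a + Complex.I • b) * (a + Complex.I • b) - star a * a - star b * b)) := by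
      rw [eq_inv_smul_iff₀ two_ne_zero]
      simp only [star_add, star_smul, mul_add, add_mul, smul_mul_assoc, mul_smul_comm,
        RCLike.star_def, Complex.conj_I, smul_smul, smul_add, smul_sub, Complex.I_mul_I,
        neg_mul, neg_neg, neg_smul, one_smul, two_smul, smul_neg]
      abel
    rw [h3]
    exact D.smul_mem _ (add_mem (sub_mem (sub_mem h1 (hD a ha)) (hD b hb))
      (D.smul_mem _ (sub_mem (sub_mem h2 (hD a ha)) (hD b hb))))
  · rintro _ ⟨a, ha, rfl⟩
    exact star_mul_mem_gramDomain ha ha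

/-- N* is dense, so the closure contains y a for y ∈ A and a ∈ N, then for all a ∈ A; an approximate
unit finishes. -/
lemma dense_gramDomain (hd : Dense (Λ.domain : Set A)) : Dense (gramDomain Λ : Set A) := by
  intro x
  have h1 : ∀ a ∈ Λ.domain, ∀ y, y * a ∈ closure (gramDomain Λ : Set A) := by
    intro a ha y
    have hs : Dense (star ⁻¹' (Λ.domain : Set A)) := hd.preimage (starL ℂ : A ≃L⋆[ℂ] A).isOpenMap
    refine closure_mono ?_ (image_closure_subset_closure_image (f := fun y : A => y * a)
      (by fun_prop) ⟨y, hs y, rfl⟩)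
    rintro _ ⟨b, hb, rfl⟩
    simpa using star_mul_mem_gramDomain (Λ := Λ) ha hb
  have h2 : ∀ y a, y * a ∈ closure (gramDomain Λ : Set A) := by
    intro y a
    refine closure_minimal ?_ isClosed_closure (image_closure_subset_closure_image
      (f := fun a : A => y * a) (by fun_prop) ⟨a, hd a, rfl⟩)
    rintro _ ⟨b, hb, rfl⟩
    exact h1 b hb y
  refine isClosed_closure.mem_of_tendsto
    ((CStarAlgebra.increasingApproximateUnit A).tendsto_mul_right x)
    (Eventually.of_forall fun e => h2 _ _)

include hA in
lemma IsGramMap.unique {φ ψ : A →ₗ.[ℂ] 𝓜(ℂ, B)} (hφ : IsGramMap Λ φ)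
    (hψ : IsGramMap Λ ψ) : ψ = φ := by
  refine LinearPMap.ext (hψ.domain_eq.trans hφ.domain_eq.symm) fun x hx hx' => ?_
  have hx2 : x ∈ gramDomain Λ := by rw [hφ.domain_eq] at hx'; exact hx'
  obtain ⟨n, a, b, rfl⟩ := exists_eq_sum_of_mem_gramDomain hx2
  refine multiplier_ext fun c => ?_
  obtain ⟨_, h1⟩ := hφ.map_sum n a b _ fun j => (hA (b j)).choose_spec
  obtain ⟨_, h2⟩ := hψ.map_sum n a b _ fun j => (hA (b j)).choose_spec
  rw [h1, h2]

variable {I : Type*} [Preorder I] {u : I → 𝓜(ℂ, A)}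
  {S : I → Adjointable B E} {ρ : I → A →ₗ[ℂ] 𝓜(ℂ, B)}

namespace IsTruncation

variable (h : IsTruncation Λ u S ρ)
include h

/-- ρ_i(b* a) = Λ(b)* S_i* S_i Λ(a), and S_i* S_i → 1 strongly. -/
lemma tendsto_rho_mul (b a : Λ.domain) : Tendsto (fun i => ρ i (star (b : A) * a)) atTop
    (@nhds _ (strictTopology B) (gramMul hA 1 b a)) := by
  have h1 : ∀ i, ρ i (star (b : A) * a) = gramMul hA (star (S i) * S i) b a := fun i =>
    eq_gramMul hA fun c d => by
      rw [h.gram]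
      simpa using ((S i).isAdjoint.symm ((S i).toCLM (Λ a c)) (Λ b d)).symm
  simp only [h1]
  refine tendsto_gramMul hA (fun v => h.tendsto_star_mul_S v) (fun v => ?_) b a
  simpa using h.tendsto_star_mul_S v

include hA in
-- The source of well-definedness: the ρ_i are defined on A itself, so their limit cannot depend on
-- how x is written as a sum of products.
lemma exists_tendsto_rho {x : A} (hx : x ∈ gramDomain Λ) :
    ∃ m, Tendsto (fun i => ρ i x) atTop (@nhds _ (strictTopology B) m) := by
  induction hx using Submodule.span_induction with
  | mem x hx =>
    obtain ⟨a, ha, b, hb, rfl⟩ := hx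
    exact ⟨_, h.tendsto_rho_mul hA ⟨b, hb⟩ ⟨a, ha⟩⟩
  | zero =>
    refine ⟨0, ?_⟩
    simpa using tendsto_strict_iff.2 ⟨fun _ => tendsto_const_nhds, fun _ => tendsto_const_nhds⟩
  | add x y _ _ hx hy =>
    obtain ⟨m, hm⟩ := hx
    obtain ⟨n, hn⟩ := hy
    exact ⟨m + n, by simpa using tendsto_strict_add hm hn⟩
  | smul z x _ hx =>
    obtain ⟨m, hm⟩ := hx
    exact ⟨z • m, by simpa using tendsto_strict_smul z hm⟩

variable [IsDirectedOrder I] [Nonempty I]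

/-- The weight defined by a truncation, as the strict limit of the maps `ρ i`. -/
noncomputable def weight : A →ₗ.[ℂ] 𝓜(ℂ, B) where
  domain := gramDomain Λ
  toFun :=
    { toFun := fun x => (h.exists_tendsto_rho hA x.2).choose
      map_add' := fun x y => tendsto_strict_unique (h.exists_tendsto_rho hA (x + y).2).choose_spec
        (by simpa using tendsto_strict_add (h.exists_tendsto_rho hA x.2).choose_spec
              (h.exists_tendsto_rho hA y.2).choose_spec)
      map_smul' := fun z x => tendsto_strict_unique (h.exists_tendsto_rho hA (z • x).2).choose_spec
        (by simpa using tendsto_strict_smul z (h.exists_tendsto_rho hA x.2).choose_spec) }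

lemma weight_domain : (h.weight hA).domain = gramDomain Λ := rfl

lemma tendsto_weight (x : (h.weight hA).domain) :
    Tendsto (fun i => ρ i x) atTop (@nhds _ (strictTopology B) (h.weight hA x)) :=
  (h.exists_tendsto_rho hA x.2).choose_spec

lemma weight_star_mul (b a : Λ.domain) (hx : star (b : A) * (a : A) ∈ (h.weight hA).domain) :
    h.weight hA ⟨star (b : A) * a, hx⟩ = gramMul hA 1 b a :=
  tendsto_strict_unique (h.tendsto_weight hA ⟨_, hx⟩) (h.tendsto_rho_mul hA b a)

lemma isGramMap_weight : IsGramMap Λ (h.weight hA) where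
  domain_eq := rfl
  map_sum n a b s hs := by
    refine ⟨sum_mem fun j _ => star_mul_mem_gramDomain (a j).2 (b j).2, fun c => ?_⟩
    have h1 := (tendsto_strict_iff.1 (h.tendsto_weight hA ⟨∑ j, star (b j : A) * (a j : A),
      sum_mem fun j _ => star_mul_mem_gramDomain (a j).2 (b j).2⟩)).1 c
    refine tendsto_nhds_unique h1 ?_
    have h2 : ∀ i, (ρ i (∑ j, star (b j : A) * (a j : A))).fst c =
        ∑ j, (ρ i (star (b j : A) * (a j : A))).fst c := fun i =>
      map_sum ((h.isStrict i).evalCLM c) _ _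
    simp only [h2]
    refine tendsto_finsetSum _ fun j _ => ?_
    have h3 := (tendsto_strict_iff.1 (h.tendsto_rho_mul hA (b j) (a j))).1 c
    rw [(hs j).unique (hA (b j)).choose_spec]
    exact h3

lemma mem_of_star_mul_le_mem (hd : Dense (Λ.domain : Set A)) (hc : IsNormStronglyClosed Λ)
    {a x : A} (hax : star a * a ≤ x) (hx : x ∈ gramDomain Λ) : a ∈ Λ.domain := by
  obtain ⟨n, c, hxc⟩ := exists_le_sum_of_mem_gramDomain hx
    ((star_mul_self_nonneg a).trans hax)
  exact h.mem_of_star_mul_le hd hc c (hax.trans hxc)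

lemma sqDomain_weight (hd : Dense (Λ.domain : Set A)) (hc : IsNormStronglyClosed Λ) :
    sqDomain (h.weight hA) = (Λ.domain : Set A) := by
  ext a
  refine ⟨fun ha => h.mem_of_star_mul_le_mem hd hc le_rfl ha.2,
    fun ha => ⟨star_mul_self_nonneg a, star_mul_mem_gramDomain ha ha⟩⟩

lemma ip_eq_weight (a₁ a₂ : Λ.domain) (b₁ b₂ : B)
    (hx : star (a₂ : A) * (a₁ : A) ∈ (h.weight hA).domain) :
    ip B (Λ a₁ b₁) (Λ a₂ b₂) =
      star b₂ * (h.weight hA ⟨star (a₂ : A) * (a₁ : A), hx⟩).fst b₁ := by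
  rw [h.weight_star_mul, star_mul_gramMul]
  rfl

lemma isWeight_weight (hd : Dense (Λ.domain : Set A)) (hc : IsNormStronglyClosed Λ) :
    IsWeight (h.weight hA) where
  hereditaryCone :=
    { nonneg := fun x hx => hx.1
      zero_mem := ⟨le_rfl, zero_mem _⟩
      add_mem := fun x hx y hy => ⟨add_nonneg hx.1 hy.1, add_mem hx.2 hy.2⟩
      smul_mem := fun r hr x hx => ⟨smul_nonneg hr hx.1, by
        rw [← Complex.coe_smul]
        exact Submodule.smul_mem _ _ hx.2⟩
      hereditary := fun x hx y hy hyx => by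
        obtain ⟨a, rfl⟩ := CStarAlgebra.nonneg_iff_eq_star_mul_self.1 hy
        have ha := h.mem_of_star_mul_le_mem hd hc hyx hx.2
        exact ⟨hy, star_mul_mem_gramDomain ha ha⟩ }
  domain_eq_span := by
    refine le_antisymm ?_ (Submodule.span_le.2 fun x hx => hx.2)
    rw [weight_domain, gramDomain_eq_span_squares]
    refine Submodule.span_mono ?_
    rintro _ ⟨a, ha, rfl⟩
    exact ⟨star_mul_self_nonneg a, star_mul_mem_gramDomain ha ha⟩
  mul_mem a ha b hb := by
    rw [h.sqDomain_weight hA hd hc] at ha hb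
    exact star_mul_mem_gramDomain ha hb
  domain_eq_span_mul := by
    rw [h.sqDomain_weight hA hd hc]
    rfl
  completelyPositive n a ha b := by
    rw [h.sqDomain_weight hA hd hc] at ha
    -- Complete positivity is ⟨v, v⟩ ≥ 0 for v = ∑ Λ(a_i)b_i.
    have h1 := ip_self_nonneg (B := B) (∑ i, Λ ⟨a i, ha i⟩ (b i))
    rw [ip_sum_left] at h1
    simp only [ip_sum_right] at h1
    refine h1.trans_eq (Finset.sum_congr rfl fun i _ => Finset.sum_congr rfl fun j _ => ?_)
    exact h.ip_eq_weight hA ⟨a i, ha i⟩ ⟨a j, ha j⟩ (b i) (b j) _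

end IsTruncation
end Weight

/-- There is a self-adjoint `y` with `(‖x‖ - y)² = ‖x‖² - x* x`. -/
lemma exists_two_smul_sub_mul_self {A : Type*} [NonUnitalCStarAlgebra A] [PartialOrder A]
    [StarOrderedRing A] (x : A) :
    ∃ y : A, star y = y ∧ (2 * ‖x‖) • y - y * y = star x * x := by
  set p := star x * x
  have hp : IsSelfAdjoint p := IsSelfAdjoint.star_mul_self x
  -- √(‖x‖² − x* x) needs a unit; its difference from ‖x‖ is a function vanishing at 0, so the
  -- non-unital calculus applies.
  set f : ℝ → ℝ := fun t => ‖x‖ - √(‖x‖ ^ 2 - t) with hf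
  have hfc : Continuous f := by fun_prop
  have hf0 : f 0 = 0 := by simp [hf]
  refine ⟨cfcₙ f p, (cfcₙ_predicate f p : IsSelfAdjoint _), ?_⟩
  rw [← cfcₙ_const_mul (2 * ‖x‖) f p hfc.continuousOn hf0,
    ← cfcₙ_mul f f p hfc.continuousOn hf0 hfc.continuousOn hf0,
    ← cfcₙ_sub _ _ p (by fun_prop) (by simp [hf0]) (by fun_prop) (by simp [hf0])]
  conv_rhs => rw [← cfcₙ_id ℝ p hp]
  refine cfcₙ_congr fun t ht => ?_
  have h1 := NonUnitalIsometricContinuousFunctionalCalculus.norm_quasispectrum_le p ht hp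
  rw [CStarRing.norm_star_mul_self, Real.norm_eq_abs] at h1
  have h2 : 0 ≤ ‖x‖ ^ 2 - t := by nlinarith [le_abs_self t]
  have h3 := Real.sq_sqrt h2
  simp only [hf, id]
  nlinarith

/-! ### The representation π. -/

section Representation

variable {A B E : Type*} [NonUnitalCStarAlgebra A] [PartialOrder A] [StarOrderedRing A]
  [NonUnitalCStarAlgebra B] [PartialOrder B] [StarOrderedRing B]
  [NormedAddCommGroup E] [NormedSpace ℂ E] [CompleteSpace E]
  [SMul Bᵐᵒᵖ E] [CStarModule Bᵐᵒᵖ E]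

variable {Λ : A →ₗ.[ℂ] (B →ₗ[ℂ] E)}

variable (Λ) in
/-- The map `a ⊗ b ↦ Λ(a) b`. -/
noncomputable def tensorMap : TensorProduct ℂ Λ.domain B →ₗ[ℂ] E := TensorProduct.lift Λ.toFun

@[simp] lemma tensorMap_tmul (a : Λ.domain) (b : B) : tensorMap Λ (a ⊗ₜ b) = Λ a b := rfl

/-- Left multiplication on the domain of `Λ`. -/
def leftMul (hI : ∀ x : A, ∀ a ∈ Λ.domain, x * a ∈ Λ.domain) (x : A) : Λ.domain →ₗ[ℂ] Λ.domain where
  toFun a := ⟨x * a, hI x a a.2⟩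
  map_add' a b := by ext; simp [mul_add]
  map_smul' z a := by ext; simp [mul_smul_comm]

lemma denseRange_tensorMap (hr : HasDenseRange Λ) : DenseRange (tensorMap Λ) := by
  have : Submodule.span ℂ {v : E | ∃ (a : Λ.domain) (b : B), v = Λ a b} ≤
      LinearMap.range (tensorMap Λ) := by
    refine Submodule.span_le.2 ?_
    rintro _ ⟨a, b, rfl⟩
    exact ⟨a ⊗ₜ b, rfl⟩
  exact hr.mono this

variable (hI : ∀ x : A, ∀ a ∈ Λ.domain, x * a ∈ Λ.domain)

/-- Left multiplication on the first factor of the tensor product. -/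
noncomputable def tensorMul (x : A) :
    TensorProduct ℂ Λ.domain B →ₗ[ℂ] TensorProduct ℂ Λ.domain B :=
  TensorProduct.map (leftMul hI x) LinearMap.id

@[simp] lemma tensorMul_tmul (x : A) (a : Λ.domain) (b : B) :
    tensorMul hI x (a ⊗ₜ b) = leftMul hI x a ⊗ₜ b := rfl

lemma tensorMul_mul (x y : A) (t : TensorProduct ℂ Λ.domain B) :
    tensorMul hI (x * y) t = tensorMul hI x (tensorMul hI y t) := by
  induction t using TensorProduct.induction_on with
  | zero => simp
  | tmul a b =>
    simp only [tensorMul_tmul]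
    congr 1
    ext
    simp [leftMul, mul_assoc]
  | add s t hs ht => simp only [map_add, hs, ht]

lemma tensorMul_add (x y : A) (t : TensorProduct ℂ Λ.domain B) :
    tensorMul hI (x + y) t = tensorMul hI x t + tensorMul hI y t := by
  induction t using TensorProduct.induction_on with
  | zero => simp
  | tmul a b =>
    simp only [tensorMul_tmul, ← TensorProduct.add_tmul]
    congr 1
    ext
    simp [leftMul, add_mul]
  | add s t hs ht => simp only [map_add, hs, ht]; abel

lemma tensorMul_smul (z : ℂ) (x : A) (t : TensorProduct ℂ Λ.domain B) :
    tensorMul hI (z • x) t = z • tensorMul hI x t := by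
  induction t using TensorProduct.induction_on with
  | zero => simp
  | tmul a b =>
    simp only [tensorMul_tmul, TensorProduct.smul_tmul']
    congr 1
    ext
    simp [leftMul, smul_mul_assoc]
  | add s t hs ht => simp only [map_add, hs, ht, smul_add]

variable {I : Type*} [Preorder I] [IsDirectedOrder I] [Nonempty I] {u : I → 𝓜(ℂ, A)}
  {S : I → Adjointable B E} {ρ : I → A →ₗ[ℂ] 𝓜(ℂ, B)}

namespace IsTruncation

variable (h : IsTruncation Λ u S ρ)
include h

/-- After inserting S_i both sides equal d* ρ_i(c* x a) b; then pass to the limit in i. -/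
lemma ip_leftMul (x : A) (a c : Λ.domain) (b d : B) :
    ip B (Λ (leftMul hI x a) b) (Λ c d) = ip B (Λ a b) (Λ (leftMul hI (star x) c) d) := by
  have h1 := fun v w => tendsto_ip (B := B) (h.tendsto_S v) (h.tendsto_S w)
  refine tendsto_nhds_unique (h1 _ _) ((h1 (Λ a b) (Λ (leftMul hI (star x) c) d)).congr fun i => ?_)
  rw [← h.gram, ← h.gram]
  simp [leftMul, mul_assoc]

lemma ip_tensorMul (x : A) (s t : TensorProduct ℂ Λ.domain B) :
    ip B (tensorMap Λ (tensorMul hI x s)) (tensorMap Λ t) =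
      ip B (tensorMap Λ s) (tensorMap Λ (tensorMul hI (star x) t)) := by
  induction s using TensorProduct.induction_on with
  | zero => simp
  | add s s' hs hs' => simp only [map_add, ip_add_left, hs, hs']
  | tmul a b =>
    induction t using TensorProduct.induction_on with
    | zero => simp
    | add t t' ht ht' => simp only [map_add, ip_add_right, ht, ht']
    | tmul c d => exact h.ip_leftMul hI x a c b d

/-- With y as in `exists_two_smul_sub_mul_self`, ‖x‖²⟨v, v⟩ − ⟨xv, xv⟩ = ⟨(‖x‖ − y)v, (‖x‖ − y)v⟩ ≥
0. In particular left multiplication preserves the kernel of `tensorMap Λ`. -/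
lemma norm_tensorMul_le (x : A) (t : TensorProduct ℂ Λ.domain B) :
    ‖tensorMap Λ (tensorMul hI x t)‖ ≤ ‖x‖ * ‖tensorMap Λ t‖ := by
  obtain ⟨y, hy, hxy⟩ := exists_two_smul_sub_mul_self x
  set v := tensorMap Λ t
  set w := tensorMap Λ (tensorMul hI y t) with hw
  have h1 : ip B (tensorMap Λ (tensorMul hI x t)) (tensorMap Λ (tensorMul hI x t)) =
      (2 * ‖x‖) • ip B w v - ip B w w := by
    have h0 : tensorMul hI (star x * x) t =
        ((2 * ‖x‖ : ℝ) : ℂ) • tensorMul hI y t + (-1 : ℂ) • tensorMul hI y (tensorMul hI y t) := by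
      rw [← tensorMul_mul, ← tensorMul_smul, ← tensorMul_smul, ← tensorMul_add, ← hxy,
        Complex.coe_smul, neg_one_smul, sub_eq_add_neg]
    have h0' : ip B (tensorMap Λ (tensorMul hI (star x * x) t)) v =
        ip B (tensorMap Λ (tensorMul hI x t)) (tensorMap Λ (tensorMul hI x t)) := by
      rw [tensorMul_mul, h.ip_tensorMul, star_star]
    rw [← h0', h0, map_add, map_smul, map_smul, ip_add_left, ip_real_smul_left, ip_smul_left,
      h.ip_tensorMul hI y (tensorMul hI y t), hy, neg_one_smul, ← sub_eq_add_neg]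
  have h2 : ip B v w = ip B w v := by
    rw [hw, h.ip_tensorMul, hy]
  have h3 := ip_self_nonneg (B := B) ((‖x‖ : ℂ) • v - w)
  simp only [ip_sub_left, ip_sub_right, ip_real_smul_left, ip_real_smul_right, h2] at h3
  have h4 : ip B (tensorMap Λ (tensorMul hI x t)) (tensorMap Λ (tensorMul hI x t)) ≤
      (‖x‖ ^ 2) • ip B v v := by
    rw [h1, ← sub_nonneg]
    convert h3 using 1
    rw [smul_sub, smul_smul, two_mul, add_smul, sq]
    abel
  have h5 := CStarAlgebra.norm_le_norm_of_nonneg_of_le (ip_self_nonneg _) h4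
  rw [norm_smul, norm_ip_self, norm_ip_self, Real.norm_of_nonneg (by positivity), ← mul_pow] at h5
  exact (pow_le_pow_iff_left₀ (norm_nonneg _) (by positivity) two_ne_zero).1 h5

/-- The representation of `A` with `π(x) Λ(a) = Λ(x a)`. -/
noncomputable def repCLM (_ : IsTruncation Λ u S ρ) (x : A) : E →L[ℂ] E :=
  (tensorMap Λ ∘ₗ tensorMul hI x).extendOfNorm (tensorMap Λ)

variable (hr : HasDenseRange Λ)
include hr

lemma repCLM_tensorMap (x : A) (t : TensorProduct ℂ Λ.domain B) :
    h.repCLM hI x (tensorMap Λ t) = tensorMap Λ (tensorMul hI x t) :=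
  LinearMap.extendOfNorm_eq (denseRange_tensorMap hr) ⟨‖x‖, fun t => h.norm_tensorMul_le hI x t⟩ t

omit h in
lemma clm_ext_tensorMap {F : Type*} [NormedAddCommGroup F] [NormedSpace ℂ F] {f g : E →L[ℂ] F}
    (hfg : ∀ t, f (tensorMap Λ t) = g (tensorMap Λ t)) : f = g :=
  ContinuousLinearMap.coeFn_injective
    ((denseRange_tensorMap hr).equalizer f.continuous g.continuous (funext hfg))

/-- The representation of `A` with `π(x) Λ(a) = Λ(x a)`. -/
noncomputable def rep : A →ₙₐ[ℂ] (E →L[ℂ] E) where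
  toFun := h.repCLM hI
  map_smul' z x := clm_ext_tensorMap hr fun t => by
    simp [h.repCLM_tensorMap hI hr, tensorMul_smul]
  map_zero' := clm_ext_tensorMap hr fun t => by
    have := tensorMul_smul hI 0 0 t
    rw [zero_smul, zero_smul] at this
    simp [h.repCLM_tensorMap hI hr, this]
  map_add' x y := clm_ext_tensorMap hr fun t => by
    simp [h.repCLM_tensorMap hI hr, tensorMul_add]
  map_mul' x y := clm_ext_tensorMap hr fun t => by
    simp [h.repCLM_tensorMap hI hr, tensorMul_mul]

lemma rep_apply (x : A) (a : Λ.domain) (b : B) :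
    h.rep hI hr x (Λ a b) = Λ ⟨x * a, hI x a a.2⟩ b :=
  h.repCLM_tensorMap hI hr x (a ⊗ₜ b)

lemma norm_rep_apply_le (x : A) (v : E) : ‖h.rep hI hr x v‖ ≤ ‖x‖ * ‖v‖ :=
  LinearMap.norm_extendOfNorm_apply_le (denseRange_tensorMap hr) ‖x‖
    (fun t => h.norm_tensorMul_le hI x t) v

lemma isAdjoint_rep (x : A) : IsAdjoint B (h.rep hI hr x) (h.rep hI hr (star x)) := by
  intro v w
  refine (denseRange_tensorMap hr).induction_on₂
    (p := fun v w => ip B (h.rep hI hr x v) w = ip B v (h.rep hI hr (star x) w))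
    (isClosed_eq ?_ ?_) (fun s t => ?_) v w
  · exact continuous_ip.comp (f := fun p : E × E => (h.rep hI hr x p.1, p.2)) (by fun_prop)
  · exact continuous_ip.comp (f := fun p : E × E => (p.1, h.rep hI hr (star x) p.2)) (by fun_prop)
  · exact (congr_arg₂ _ (h.repCLM_tensorMap hI hr x s) rfl).trans ((h.ip_tensorMul hI x s t).trans
      (congr_arg₂ _ rfl (h.repCLM_tensorMap hI hr (star x) t).symm))

omit hr in
-- S_i Λ is norm continuous, whereas Λ need not be.
lemma tendsto_S_apply {κ : Type*} {l : Filter κ} {f : κ → Λ.domain} {a : Λ.domain}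
    (hf : Tendsto (fun k => (f k : A)) l (𝓝 (a : A))) (i : I) (b : B) :
    Tendsto (fun k => (S i).toCLM (Λ (f k) b)) l (𝓝 ((S i).toCLM (Λ a b))) := by
  rw [tendsto_iff_norm_sub_tendsto_zero]
  have h1 : ∀ k, ‖(S i).toCLM (Λ (f k) b) - (S i).toCLM (Λ a b)‖ =
      √‖star b * (ρ i (star (f k - a : A) * (f k - a : A))).fst b‖ := fun k => by
    rw [← Real.sqrt_sq (norm_nonneg _), ← map_sub, ← LinearMap.sub_apply, ← LinearPMap.map_sub,
      h.norm_sq_S_apply]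
    rfl
  simp only [h1]
  have h2 : Tendsto (fun k => (f k - a : A)) l (𝓝 0) := by
    simpa using hf.sub_const (a : A)
  have h3 := (((h.isStrict i).continuous_fst b).tendsto _).comp (h2.star.mul h2)
  simpa [Function.comp_def] using (Real.continuous_sqrt.tendsto _).comp
    (h3.const_mul (star b)).norm

/-- Already the vectors `π(x) v` with `x` in a dense subset span a dense subspace. -/
lemma dense_span_rep {D : Set A} (hD : Dense D) :
    Dense (Submodule.span ℂ {w : E | ∃ x ∈ D, ∃ v : E, w = h.rep hI hr x v} : Set E) := by
  set R := Submodule.span ℂ {w : E | ∃ x ∈ D, ∃ v : E, w = h.rep hI hr x v}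
  have h0 : ∀ x v, h.rep hI hr x v ∈ R.topologicalClosure := by
    intro x v
    have hcont : Continuous fun x : A => h.rep hI hr x v := by
      refine (AddMonoidHomClass.continuous_of_bound
        (((ContinuousLinearMap.apply ℂ E v).toAddMonoidHom).comp
          (h.rep hI hr : A →+ (E →L[ℂ] E))) ‖v‖ fun x => ?_)
      rw [mul_comm]
      exact h.norm_rep_apply_le hI hr x v
    refine closure_mono ?_ (image_closure_subset_closure_image hcont ⟨x, hD x, rfl⟩)
    rintro _ ⟨y, hy, rfl⟩
    exact Submodule.subset_span ⟨y, hy, v, rfl⟩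
  rw [Submodule.dense_iff_topologicalClosure_eq_top, eq_top_iff,
    ← (Submodule.dense_iff_topologicalClosure_eq_top.1 hr)]
  refine Submodule.topologicalClosure_minimal _ (Submodule.span_le.2 ?_)
    (Submodule.isClosed_topologicalClosure _)
  rintro _ ⟨a, b, rfl⟩
  refine (Submodule.isClosed_topologicalClosure R).mem_of_tendsto (h.tendsto_S (Λ a b))
    (Eventually.of_forall fun i => ?_)
  -- For e in the approximate unit, S_i Λ(ea)b = π(e) S_i Λ(a)b, because left multiplication by e
  -- commutes with right multiplication by u_i.
  have h1 := h.tendsto_S_apply (f := fun e : A => leftMul hI e a) (a := a)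
    ((CStarAlgebra.increasingApproximateUnit A).tendsto_mul_right (a : A)) i b
  refine (Submodule.isClosed_topologicalClosure R).mem_of_tendsto h1
    (Eventually.of_forall fun e => ?_)
  have h2 : (S i).toCLM (Λ (leftMul hI e a) b) = h.rep hI hr e ((S i).toCLM (Λ a b)) := by
    rw [h.apply, h.apply, h.rep_apply]
    congr 2
    exact Subtype.ext (multiplier_snd_mul _ _ _)
  rw [h2]
  exact h0 _ _

lemma isNondegenerate_rep : IsNondegenerate (h.rep hI hr) := by
  refine (h.dense_span_rep hI hr dense_univ).mono (Submodule.span_mono ?_)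
  rintro _ ⟨x, -, v, rfl⟩
  exact ⟨x, v, rfl⟩

lemma isKSGNS_rep (hA : ∀ a, IsAdjointable B (Λ a)) (hd : Dense (Λ.domain : Set A))
    (hc : IsNormStronglyClosed Λ) : IsKSGNS (h.weight hA) Λ (h.rep hI hr) where
  domain_eq := (h.sqDomain_weight hA hd hc).symm
  adjointable := hA
  denseRange := hr
  inner_eq a₁ a₂ b₁ b₂ := ⟨star_mul_mem_gramDomain a₁.2 a₂.2, h.ip_eq_weight hA a₁ a₂ b₁ b₂ _⟩
  star_map := h.isAdjoint_rep hI hr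
  map_apply x a := ⟨hI x a a.2, h.rep_apply hI hr x a⟩

end IsTruncation

lemma IsKSGNS.unique {φ : A →ₗ.[ℂ] 𝓜(ℂ, B)} {π π' : A →ₙₐ[ℂ] (E →L[ℂ] E)} (h : IsKSGNS φ Λ π)
    (h' : IsKSGNS φ Λ π') : π' = π := by
  refine NonUnitalAlgHom.ext fun x => ContinuousLinearMap.ext_on h.denseRange ?_
  rintro _ ⟨a, b, rfl⟩
  obtain ⟨_, h1⟩ := h.map_apply x a
  obtain ⟨_, h2⟩ := h'.map_apply x a
  rw [h1, h2]

end Representation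

/-- Two positive elements of norm at most `t < 1` have a common upper bound of norm less than `1`
which is dominated by a multiple of their sum. -/
lemma exists_common_bound {𝒜 : Type*} [CStarAlgebra 𝒜] [PartialOrder 𝒜] [StarOrderedRing 𝒜]
    {a b : 𝒜} (ha : 0 ≤ a) (hb : 0 ≤ b) {t : ℝ} (ht : t < 1) (hat : ‖a‖ ≤ t) (hbt : ‖b‖ ≤ t) :
    ∃ R : 𝒜, 0 ≤ R ∧ ‖R‖ < 1 ∧ a ≤ R ∧ b ≤ R ∧ (∃ C : ℝ, 0 ≤ C ∧ R ≤ C • (a + b)) ∧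
      ∀ c, Commute a c → Commute b c → Commute R c := by
  -- The function x/(1 + x) is operator monotone on [0, ∞), takes values in [0, 1) and lies below x.
  set f : ℝ → ℝ := fun x => 1 - (1 + x)⁻¹ with hf
  have hcont : ∀ s : Set ℝ, (∀ x ∈ s, 0 ≤ x) → ContinuousOn f s := fun s hs =>
    continuousOn_const.sub ((continuousOn_const.add continuousOn_id).inv₀ fun x hx => by
      have := hs x hx
      exact (by positivity : 1 + x ≠ 0))
  have hf0 : f 0 = 0 := by simp [hf]
  -- Chosen so that f(x/β) = x/(β + x) ≥ x for 0 ≤ x ≤ t. Thus c ≤ f(c/β), and monotonicity gives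
  -- f(c/β) ≤ f(h).
  set β := 1 - t
  have hβ : 0 < β := by simp only [β]; linarith
  set h := β⁻¹ • (a + b)
  have hab : 0 ≤ a + b := add_nonneg ha hb
  have hh : 0 ≤ h := smul_nonneg (inv_nonneg.2 hβ.le) hab
  have hsp : ∀ c : 𝒜, 0 ≤ c → ∀ x ∈ quasispectrum ℝ c, 0 ≤ x := fun c hc =>
    quasispectrum_nonneg_of_nonneg c hc
  have key : ∀ c d : 𝒜, 0 ≤ c → ‖c‖ ≤ t → 0 ≤ d → β⁻¹ • (c + d) = h → c ≤ cfcₙ f h := by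
    intro c d hc hct hd hcd
    have h1 : β⁻¹ • c ≤ h := by
      rw [← hcd]
      exact smul_le_smul_of_nonneg_left (le_add_of_nonneg_right hd) (inv_nonneg.2 hβ.le)
    have h2 := CFC.monotoneOn_one_sub_one_add_inv_real
      (smul_nonneg (inv_nonneg.2 hβ.le) hc : 0 ≤ β⁻¹ • c) hh h1
    refine le_trans ?_ h2
    have h3 : ContinuousOn f ((fun x => β⁻¹ * x) '' quasispectrum ℝ c) := by
      refine hcont _ ?_
      rintro _ ⟨x, hx, rfl⟩
      exact mul_nonneg (inv_nonneg.2 hβ.le) (hsp c hc x hx)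
    rw [← cfcₙ_comp_const_mul β⁻¹ f c h3 hf0 hc.isSelfAdjoint]
    conv_lhs => rw [← cfcₙ_id ℝ c hc.isSelfAdjoint]
    refine cfcₙ_mono (fun x hx => ?_) continuousOn_id
      (h3.comp (by fun_prop) (Set.mapsTo_image _ _)) rfl (by simp [hf0])
    have hx0 := hsp c hc x hx
    have hxt : x ≤ t := (le_abs_self x).trans
      ((NonUnitalIsometricContinuousFunctionalCalculus.norm_quasispectrum_le c hx
        hc.isSelfAdjoint).trans hct)
    have e : f (β⁻¹ * x) = x / (β + x) := by
      simp only [hf]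
      have : β + x ≠ 0 := by positivity
      field_simp
      ring
    change x ≤ f (β⁻¹ * x)
    rw [e, le_div_iff₀ (by positivity)]
    simp only [β]
    nlinarith
  have hR0 : 0 ≤ cfcₙ f h := cfcₙ_nonneg fun x hx => by
    have := hsp h hh x hx
    simp only [hf, sub_nonneg]
    exact inv_le_one_of_one_le₀ (by linarith)
  refine ⟨cfcₙ f h, hR0, ?_, key a b ha hat hb rfl, key b a hb hbt ha (by rw [add_comm]),
    ⟨β⁻¹, inv_nonneg.2 hβ.le, ?_⟩, fun c hac hbc => ?_⟩
  · refine norm_cfcₙ_lt fun x hx => ?_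
    have := hsp h hh x hx
    simp only [hf, Real.norm_eq_abs, abs_lt]
    have h1 : (1 + x)⁻¹ ≤ 1 := inv_le_one_of_one_le₀ (by linarith)
    have h2 : 0 < (1 + x)⁻¹ := by positivity
    constructor <;> linarith
  · change cfcₙ f h ≤ h
    conv_rhs => rw [← cfcₙ_id ℝ h hh.isSelfAdjoint]
    refine cfcₙ_mono (fun x hx => ?_) (hcont _ (hsp h hh)) continuousOn_id hf0 rfl
    have := hsp h hh x hx
    simp only [hf, id]
    have h2 : (1 + x) * (1 + x)⁻¹ = 1 := mul_inv_cancel₀ (by positivity)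
    have h3 : 0 < (1 + x)⁻¹ := by positivity
    have h1 : (1 + x)⁻¹ ≤ 1 := inv_le_one_of_one_le₀ (by linarith)
    nlinarith
  · exact ((hac.add_left hbc).smul_left β⁻¹).cfcₙ_real f

/-! ### The families F and G described by operators. -/

section Families

variable {A B E : Type*} [NonUnitalCStarAlgebra A] [PartialOrder A] [StarOrderedRing A]
  [NonUnitalCStarAlgebra B] [PartialOrder B] [StarOrderedRing B]
  [NormedAddCommGroup E] [NormedSpace ℂ E] [CompleteSpace E]
  [SMul Bᵐᵒᵖ E] [CStarModule Bᵐᵒᵖ E]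

variable {Λ : A →ₗ.[ℂ] (B →ₗ[ℂ] E)} {σ τ : A →ₗ[ℂ] 𝓜(ℂ, B)} {T R : Adjointable B E}

variable (Λ) in
/-- The map `σ` is given by the operator `T`: `b₂* σ(a₂* a₁) b₁ = ⟨T Λ(a₁) b₁, Λ(a₂) b₂⟩`. -/
def IsGivenBy (σ : A →ₗ[ℂ] 𝓜(ℂ, B)) (T : Adjointable B E) : Prop :=
  ∀ (a₁ a₂ : Λ.domain) (b₁ b₂ : B),
    star b₂ * (σ (star (a₂ : A) * a₁)).fst b₁ = ip B (T.toCLM (Λ a₁ b₁)) (Λ a₂ b₂)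

lemma IsGivenBy.add (h : IsGivenBy Λ σ T) (h' : IsGivenBy Λ τ R) :
    IsGivenBy Λ (σ + τ) (T + R) := fun a₁ a₂ b₁ b₂ => by
  simp [mul_add, ip_add_left, h a₁ a₂ b₁ b₂, h' a₁ a₂ b₁ b₂]

lemma IsGivenBy.smul (h : IsGivenBy Λ σ T) (z : ℂ) : IsGivenBy Λ (z • σ) (z • T) :=
  fun a₁ a₂ b₁ b₂ => by
    simp [mul_smul_comm, ip_smul_left, h a₁ a₂ b₁ b₂]

lemma IsGivenBy.sub (h : IsGivenBy Λ σ T) (h' : IsGivenBy Λ τ R) :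
    IsGivenBy Λ (σ - τ) (T - R) := fun a₁ a₂ b₁ b₂ => by
  simp [mul_sub, ip_sub_left, h a₁ a₂ b₁ b₂, h' a₁ a₂ b₁ b₂]

lemma IsStrict.sub (hσ : IsStrict σ) (hτ : IsStrict τ) : IsStrict (σ - τ) := by
  have e : σ - τ = σ + (-1 : ℂ) • τ := LinearMap.ext fun x => by simp [sub_eq_add_neg]
  rw [e]
  exact hσ.add (hτ.smul (-1))

lemma exists_eq_sum_of_mem_span {v : E}
    (hv : v ∈ Submodule.span ℂ {v : E | ∃ (a : Λ.domain) (b : B), v = Λ a b}) :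
    ∃ (n : ℕ) (a : Fin n → Λ.domain) (b : Fin n → B), v = ∑ j, Λ (a j) (b j) := by
  induction hv using Submodule.span_induction with
  | mem v hv =>
    obtain ⟨a, b, rfl⟩ := hv
    exact ⟨1, fun _ => a, fun _ => b, by simp⟩
  | zero => exact ⟨0, Fin.elim0, Fin.elim0, by simp⟩
  | add v w _ _ hv hw =>
    obtain ⟨n, a, b, rfl⟩ := hv
    obtain ⟨m, a', b', rfl⟩ := hw
    exact ⟨n + m, Fin.append a a', Fin.append b b', by simp [Fin.sum_univ_add]⟩
  | smul z v _ hv =>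
    obtain ⟨n, a, b, rfl⟩ := hv
    exact ⟨n, a, fun j => z • b j, by simp [Finset.smul_sum]⟩

lemma IsGivenBy.sum_eq (h : IsGivenBy Λ σ T) {n : ℕ} (a : Fin n → Λ.domain) (b : Fin n → B) :
    ∑ i, ∑ j, star (b j) * (σ (star (a j : A) * a i)).fst (b i) =
      ip B (T.toCLM (∑ i, Λ (a i) (b i))) (∑ i, Λ (a i) (b i)) := by
  rw [map_sum, ip_sum_left]
  refine Finset.sum_congr rfl fun i _ => ?_
  rw [ip_sum_right]
  exact Finset.sum_congr rfl fun j _ => h _ _ _ _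

/-- Complete positivity of σ is positivity of ⟨Tv, v⟩ on the dense set of vectors v = ∑ Λ(a_i)b_i.
With the converse `isCP_of_isGivenBy`, the order on G becomes the order of operators. -/
lemma IsGivenBy.nonneg (h : IsGivenBy Λ σ T) (hσ : IsCP σ) (hr : HasDenseRange Λ) : 0 ≤ T := by
  refine Adjointable.nonneg_iff.2 fun v => ?_
  have h1 : IsClosed {v : E | 0 ≤ ip B (T.toCLM v) v} :=
    CStarAlgebra.isClosed_nonneg.preimage
      (continuous_ip.comp (f := fun v : E => (T.toCLM v, v)) (by fun_prop))
  refine closure_minimal ?_ h1 (hr v)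
  intro v hv
  obtain ⟨n, a, b, rfl⟩ := exists_eq_sum_of_mem_span hv
  change 0 ≤ ip B _ _
  rw [← h.sum_eq]
  exact hσ n (fun i => a i) b

lemma mem_familyF_iff : σ ∈ familyF Λ ↔ IsCP σ ∧ IsStrict σ ∧
    ∃ T : Adjointable B E, 0 ≤ T ∧ ‖T‖ ≤ 1 ∧ IsGivenBy Λ σ T := by
  constructor
  · rintro ⟨h1, h2, T, hT, h3, h4, h5⟩
    obtain ⟨T, rfl⟩ := Adjointable.exists_toCLM_eq hT
    have h6 : 0 ≤ T := Adjointable.nonneg_iff.2 h3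
    exact ⟨h1, h2, T, h6, (CStarAlgebra.norm_le_one_iff_of_nonneg T h6).2
      (Adjointable.le_iff.2 h4), h5⟩
  · rintro ⟨h1, h2, T, h3, h4, h5⟩
    exact ⟨h1, h2, T.toCLM, ⟨_, T.isAdjoint⟩, Adjointable.nonneg_iff.1 h3,
      Adjointable.le_iff.1 ((CStarAlgebra.norm_le_one_iff_of_nonneg T h3).1 h4), h5⟩

/-- The scalar is absorbed into the operator, which turns ‖T‖ ≤ 1 into ‖T‖ < 1. -/
lemma mem_familyG_iff : σ ∈ familyG Λ ↔ IsCP σ ∧ IsStrict σ ∧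
    ∃ T : Adjointable B E, 0 ≤ T ∧ ‖T‖ < 1 ∧ IsGivenBy Λ σ T := by
  constructor
  · rintro ⟨t, ht0, ht1, σ, hσ, rfl⟩
    obtain ⟨h1, h2, T, h3, h4, h5⟩ := mem_familyF_iff.1 hσ
    refine ⟨h1.smul ht0, h2.smul _, (t : ℂ) • T, ?_, ?_, h5.smul _⟩
    · rw [Complex.coe_smul]; exact smul_nonneg ht0 h3
    · rw [norm_smul, Complex.norm_real, Real.norm_of_nonneg ht0]
      nlinarith [norm_nonneg T]
  · rintro ⟨h1, h2, T, h3, h4, h5⟩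
    -- The value 1/2 only keeps t invertible when T = 0.
    set t := max ‖T‖ 2⁻¹ with ht
    have ht0 : 0 < t := lt_max_of_lt_right (by norm_num)
    have ht1 : t < 1 := max_lt h4 (by norm_num)
    refine ⟨t, ht0.le, ht1, ((t⁻¹ : ℝ) : ℂ) • σ, mem_familyF_iff.2 ⟨h1.smul (inv_nonneg.2 ht0.le),
      h2.smul _, ((t⁻¹ : ℝ) : ℂ) • T, ?_, ?_, h5.smul _⟩, ?_⟩
    · rw [Complex.coe_smul]; exact smul_nonneg (inv_nonneg.2 ht0.le) h3
    · rw [norm_smul, Complex.norm_real, Real.norm_of_nonneg (inv_nonneg.2 ht0.le),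
        inv_mul_le_one₀ ht0]
      exact le_max_left _ _
    · rw [smul_smul, ← Complex.ofReal_mul, mul_inv_cancel₀ ht0.ne', Complex.ofReal_one, one_smul]

variable {I : Type*} [Preorder I] [IsDirectedOrder I] [Nonempty I] {u : I → 𝓜(ℂ, A)}
  {S : I → Adjointable B E} {ρ : I → A →ₗ[ℂ] 𝓜(ℂ, B)}

namespace IsTruncation

variable (h : IsTruncation Λ u S ρ)
include h

lemma isGivenBy (i : I) : IsGivenBy Λ (ρ i) (star (S i) * S i) := fun a₁ a₂ b₁ b₂ => by
  rw [h.gram]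
  simpa using ((S i).isAdjoint.symm ((S i).toCLM (Λ a₁ b₁)) (Λ a₂ b₂)).symm

/-- A strict map given by a positive operator is completely positive. -/
lemma isCP_of_isGivenBy (hd : Dense (Λ.domain : Set A)) (hc : IsNormStronglyClosed Λ)
    (hσ : IsStrict σ) (hT : IsGivenBy Λ σ T) (h0 : 0 ≤ T) : IsCP σ := by
  intro n a b
  have h1 : Tendsto (fun k => ∑ i, ∑ j, star (b j) *
      (σ (star ((u k).snd (a j)) * (u k).snd (a i))).fst (b i)) atTop
      (𝓝 (∑ i, ∑ j, star (b j) * (σ (star (a j) * a i)).fst (b i))) := by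
    refine tendsto_finsetSum _ fun i _ => tendsto_finsetSum _ fun j _ => Tendsto.const_mul _ ?_
    exact ((hσ.continuous_fst (b i)).tendsto _).comp
      ((h.tendsto_u_snd (a j)).star.mul (h.tendsto_u_snd (a i)))
  refine CStarAlgebra.isClosed_nonneg.mem_of_tendsto h1 (Eventually.of_forall fun k => ?_)
  -- Replacing a_i by a_i u_k ∈ N makes the operator formula available.
  have h2 := hT.sum_eq (fun i => ⟨(u k).snd (a i), h.snd_mem hd hc k (a i)⟩) b
  exact (Adjointable.nonneg_iff.1 h0 _).trans_eq h2.symm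

variable (hI : ∀ x : A, ∀ a ∈ Λ.domain, x * a ∈ Λ.domain) (hr : HasDenseRange Λ)

/-- The representation, with values in the adjointable operators. -/
noncomputable def repAdj (x : A) : Adjointable B E :=
  Adjointable.mk' (h.rep hI hr x) (h.rep hI hr (star x)) (h.isAdjoint_rep hI hr x)

/-- An operator defining a map on `A` commutes with the representation. -/
lemma commute_repAdj (hT : IsGivenBy Λ σ T) (x : A) : Commute T (h.repAdj hI hr x) := by
  refine Adjointable.toCLM_injective (ContinuousLinearMap.ext_on hr ?_)
  rintro _ ⟨a, b, rfl⟩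
  refine eq_of_forall_ip_dense (B := B) hr ?_
  rintro _ ⟨c, d, rfl⟩
  change ip B (T.toCLM (h.rep hI hr x (Λ a b))) (Λ c d) =
    ip B (h.rep hI hr x (T.toCLM (Λ a b))) (Λ c d)
  rw [h.isAdjoint_rep, h.rep_apply, h.rep_apply, ← hT, ← hT]
  simp [mul_assoc]

end IsTruncation
end Families

/-! ### Operators in the commutant that come from strict maps. -/

section Dominated

variable {A B E : Type*} [NonUnitalCStarAlgebra A] [PartialOrder A] [StarOrderedRing A]
  [NonUnitalCStarAlgebra B] [PartialOrder B] [StarOrderedRing B]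
  [NormedAddCommGroup E] [NormedSpace ℂ E] [CompleteSpace E]
  [SMul Bᵐᵒᵖ E] [CStarModule Bᵐᵒᵖ E]

variable {Λ : A →ₗ.[ℂ] (B →ₗ[ℂ] E)} {τ : A →ₗ[ℂ] 𝓜(ℂ, B)} {Y : Adjointable B E}
variable {I : Type*} [Preorder I] [IsDirectedOrder I] [Nonempty I] {u : I → 𝓜(ℂ, A)}
  {S : I → Adjointable B E} {ρ : I → A →ₗ[ℂ] 𝓜(ℂ, B)}

/-- If the family `n` and its limit `0` are bounded and `n x → 0` for all `x`, then `n* n → 0`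
strictly and boundedly, so that its images under a strict map tend to `0`. -/
lemma IsStrict.tendsto_star_mul_self (hτ : IsStrict τ) {κ : Type*} {l : Filter κ} {n : κ → A}
    {r : ℝ} (hn : ∀ᶠ k in l, ‖n k‖ ≤ r) (h0 : ∀ x, Tendsto (fun k => n k * x) l (𝓝 0)) (b : B) :
    Tendsto (fun k => (τ (star (n k) * n k)).fst b) l (𝓝 0) := by
  have h1 : ∀ x, Tendsto (fun k => star (n k) * n k * x) l (𝓝 0) := fun x => by
    refine squeeze_zero_norm' (a := fun k => r * ‖n k * x‖) ?_ (by
      simpa using ((h0 x).norm).const_mul r)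
    filter_upwards [hn] with k hk
    rw [mul_assoc]
    refine (norm_mul_le _ _).trans ?_
    rw [norm_star]
    gcongr
  have h2 : ∀ x, Tendsto (fun k => x * (star (n k) * n k)) l (𝓝 0) := fun x => by
    have := (h1 (star x)).star
    simpa [mul_assoc] using this
  have h3 := hτ.tendsto (f := fun k => star (n k) * n k) (x := 0) (r := r ^ 2) (l := l)
    (by
      filter_upwards [hn] with k hk
      rw [CStarRing.norm_star_mul_self, ← sq]
      gcongr) (by simpa using sq_nonneg r) (by simpa using h1) (by simpa using h2)
  simpa using (tendsto_strict_iff.1 h3).1 b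

namespace IsTruncation

variable (h : IsTruncation Λ u S ρ) (hI : ∀ x : A, ∀ a ∈ Λ.domain, x * a ∈ Λ.domain)
  (hr : HasDenseRange Λ)
include h

/-- On bounded sets, `π` is continuous for the topology of left multiplication on `A` and the
strong topology. -/
lemma tendsto_rep {r : ℝ} {x : A} {l : Filter A} (hl : ∀ᶠ y in l, ‖y‖ ≤ r)
    (hx : ‖x‖ ≤ r) (h1 : ∀ a, Tendsto (fun y => y * a) l (𝓝 (x * a))) (v : E) :
    Tendsto (fun y => h.rep hI hr y v) l (𝓝 (h.rep hI hr x v)) := by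
  have hr0 : 0 ≤ r := (norm_nonneg x).trans hx
  have hcont : ∀ v : E, Continuous fun x : A => h.rep hI hr x v := fun v =>
    AddMonoidHomClass.continuous_of_bound
      (((ContinuousLinearMap.apply ℂ E v).toAddMonoidHom).comp
        (h.rep hI hr : A →+ (E →L[ℂ] E))) ‖v‖ fun x => by
      rw [mul_comm]
      exact h.norm_rep_apply_le hI hr x v
  -- On vectors π(a)v the claim is norm continuity of π, as ya → xa. Non-degeneracy and the bound r
  -- extend it to E by an ε/3 argument.
  have h2 : ∀ w ∈ Submodule.span ℂ {w : E | ∃ (x : A) (v : E), w = h.rep hI hr x v},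
      Tendsto (fun y => h.rep hI hr y w) l (𝓝 (h.rep hI hr x w)) := fun w hw => by
    induction hw using Submodule.span_induction with
    | mem w hw =>
      obtain ⟨a, v, rfl⟩ := hw
      have := ((hcont v).tendsto (x * a)).comp (h1 a)
      simpa [Function.comp_def] using this
    | zero => simp [tendsto_const_nhds]
    | add w w' _ _ hw hw' => simpa using hw.add hw'
    | smul z w _ hw => simpa using hw.const_smul z
  rw [Metric.tendsto_nhds]
  intro ε hε
  obtain ⟨w, hw, hvw⟩ := Metric.mem_closure_iff.1 (h.isNondegenerate_rep hI hr v)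
    (ε / (3 * (r + 1))) (by positivity)
  rw [dist_eq_norm, lt_div_iff₀ (by positivity)] at hvw
  have h4 : ∀ y : A, ‖y‖ ≤ r → ‖h.rep hI hr y (v - w)‖ < ε / 3 := fun y hy => by
    have := h.norm_rep_apply_le hI hr y (v - w)
    nlinarith [norm_nonneg (v - w)]
  filter_upwards [Metric.tendsto_nhds.1 (h2 w hw) (ε / 3) (by positivity), hl] with y hy hyr
  rw [dist_eq_norm] at hy ⊢
  have h5 : h.rep hI hr y v - h.rep hI hr x v = h.rep hI hr y (v - w) +
      (h.rep hI hr y w - h.rep hI hr x w) - h.rep hI hr x (v - w) := by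
    simp only [map_sub]; abel
  rw [h5]
  calc _ ≤ ‖h.rep hI hr y (v - w)‖ + ‖h.rep hI hr y w - h.rep hI hr x w‖ +
        ‖h.rep hI hr x (v - w)‖ := (norm_sub_le _ _).trans (by gcongr; exact norm_add_le _ _)
    _ < ε / 3 + ε / 3 + ε / 3 := by
      gcongr
      · exact h4 y hyr
      · exact h4 x hx
    _ = ε := by ring

omit [IsDirectedOrder I] [Nonempty I] in
-- The elements e u_i, with e in an approximate unit of A, form a bounded two-sided approximate unit
-- lying in N; together with `tendsto_mul_snd` this lets Λ be evaluated near 1.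
lemma tendsto_snd_mul (x : A) : Tendsto (fun p : A × I => (u p.2).snd p.1 * x)
    (CStarAlgebra.approximateUnit A ×ˢ atTop) (𝓝 x) := by
  have hA := CStarAlgebra.increasingApproximateUnit A
  have h1 : ∀ p : A × I, (u p.2).snd p.1 * x = p.1 * ((u p.2).fst x - x) + p.1 * x := fun p => by
    rw [(u p.2).central, mul_sub, sub_add_cancel]
  simp only [h1]
  have h2 : Tendsto (fun p : A × I => ‖(u p.2).fst x - x‖) (CStarAlgebra.approximateUnit A ×ˢ atTop)
      (𝓝 0) :=
    (tendsto_iff_norm_sub_tendsto_zero.1 (h.tendsto_u_fst x)).comp tendsto_snd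
  have h3 : Tendsto (fun p : A × I => p.1 * ((u p.2).fst x - x))
      (CStarAlgebra.approximateUnit A ×ˢ atTop) (𝓝 0) := by
    refine squeeze_zero_norm' ?_ h2
    filter_upwards [tendsto_fst.eventually hA.eventually_norm] with p hp
    exact (norm_mul_le _ _).trans (mul_le_of_le_one_left (norm_nonneg _) hp)
  have h4 := h3.add ((hA.tendsto_mul_right x).comp tendsto_fst)
  rw [zero_add] at h4
  exact h4

omit [IsDirectedOrder I] [Nonempty I] in
lemma tendsto_mul_snd (x : A) : Tendsto (fun p : A × I => x * (u p.2).snd p.1)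
    (CStarAlgebra.approximateUnit A ×ˢ atTop) (𝓝 x) := by
  have hA := CStarAlgebra.increasingApproximateUnit A
  have h1 : ∀ p : A × I, x * (u p.2).snd p.1 = (u p.2).snd (x * p.1 - x) + (u p.2).snd x :=
    fun p => by rw [map_sub, sub_add_cancel, multiplier_snd_mul]
  simp only [h1]
  have h2 : Tendsto (fun p : A × I => ‖x * p.1 - x‖) (CStarAlgebra.approximateUnit A ×ˢ atTop)
      (𝓝 0) :=
    (tendsto_iff_norm_sub_tendsto_zero.1 (hA.tendsto_mul_left x)).comp tendsto_fst
  have h3 : Tendsto (fun p : A × I => (u p.2).snd (x * p.1 - x))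
      (CStarAlgebra.approximateUnit A ×ˢ atTop) (𝓝 0) :=
    squeeze_zero_norm (fun p => h.norm_snd_le _ _) h2
  have h4 := h3.add ((h.tendsto_u_snd x).comp tendsto_snd)
  rw [zero_add] at h4
  exact h4

/-- The map is σ = V* π(·) V, where V b is the limit of Y Λ(n)b for n = e u_i and stands for YΛ(1).
The limit exists because τ is strict and dominates Y Λ. Since Y commutes with π, π(a)V = Y Λ(a), and
so σ(a₂* a₁) = Λ(a₂)* Y* Y Λ(a₁). -/
lemma exists_isGivenBy (hA : ∀ a, IsAdjointable B (Λ a)) (hd : Dense (Λ.domain : Set A))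
    (hc : IsNormStronglyClosed Λ)
    (hτ : IsStrict τ) (hY : ∀ x, Commute Y (h.repAdj hI hr x))
    (hYτ : ∀ (a : Λ.domain) (b : B),
      ‖Y.toCLM (Λ a b)‖ ^ 2 ≤ ‖star b * (τ (star (a : A) * a)).fst b‖) :
    ∃ σ : A →ₗ[ℂ] 𝓜(ℂ, B), IsStrict σ ∧ IsGivenBy Λ σ (star Y * Y) := by
  set l : Filter (A × I) := CStarAlgebra.approximateUnit A ×ˢ atTop
  set n : A × I → Λ.domain := fun p => ⟨(u p.2).snd p.1, h.snd_mem hd hc p.2 p.1⟩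
  have hn : ∀ᶠ p in l, ‖(n p : A)‖ ≤ 1 := by
    filter_upwards [tendsto_fst.eventually
      (CStarAlgebra.increasingApproximateUnit A).eventually_norm] with p hp
    exact (h.norm_snd_le _ _).trans hp
  have hcauchy : ∀ b, Cauchy (map (fun p => Y.toCLM (Λ (n p) b)) l) := fun b => by
    refine cauchy_map_of_tendsto_norm_sq ?_
    have h1 := hτ.tendsto_star_mul_self (l := l ×ˢ l) (n := fun q => (n q.1 - n q.2 : A)) (r := 2)
      (by
        filter_upwards [tendsto_fst.eventually hn, tendsto_snd.eventually hn] with q h1 h2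
        exact (norm_sub_le _ _).trans (by linarith))
      (fun x => by
        simpa [sub_mul] using
          ((h.tendsto_snd_mul x).comp tendsto_fst).sub ((h.tendsto_snd_mul x).comp tendsto_snd)) b
    have h2 := (h1.const_mul (star b)).norm
    rw [mul_zero, norm_zero] at h2
    refine squeeze_zero (fun _ => by positivity) (fun q => ?_) h2
    have := hYτ (n q.1 - n q.2) b
    rwa [LinearPMap.map_sub, LinearMap.sub_apply, map_sub] at this
  choose V hV using fun b => CompleteSpace.complete (hcauchy b)
  replace hV : ∀ b, Tendsto (fun p => Y.toCLM (Λ (n p) b)) l (𝓝 (V b)) := hV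
  -- Uniform boundedness over the unit ball of N, which eventually contains all n_p.
  obtain ⟨C, hC⟩ : ∃ C, ∀ b, ‖V b‖ ≤ C * ‖b‖ := by
    let g : {a : Λ.domain // ‖(a : A)‖ ≤ 1} → B →L[ℂ] E := fun a =>
      Y.toCLM ∘L (hA a).choose_spec.toCLM
    obtain ⟨C, hC⟩ := banach_steinhaus (g := g) fun b =>
      ⟨√(‖b‖ * ‖hτ.evalCLM b‖), fun a => by
        refine Real.le_sqrt_of_sq_le ((hYτ a b).trans ((norm_mul_le _ _).trans ?_))
        rw [norm_star]
        gcongr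
        refine (ContinuousLinearMap.le_opNorm (hτ.evalCLM b) _).trans
          (mul_le_of_le_one_right (norm_nonneg _) ?_)
        rw [CStarRing.norm_star_mul_self]
        exact mul_le_one₀ a.2 (norm_nonneg _) a.2⟩
    refine ⟨C, fun b => le_of_tendsto (hV b).norm ?_⟩
    filter_upwards [hn] with p hp
    exact (g ⟨n p, hp⟩).le_of_opNorm_le (hC _) b
  let V' : B →L[ℂ] E := LinearMap.mkContinuous
    { toFun := V
      map_add' := fun b c => tendsto_nhds_unique (hV (b + c)) (by simpa using (hV b).add (hV c))
      map_smul' := fun z c => tendsto_nhds_unique (hV (z • c))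
        (by simpa using (hV c).const_smul z) } C hC
  have hπV : ∀ (a : Λ.domain) (b : B), h.rep hI hr a (V b) = Y.toCLM (Λ a b) := by
    intro a b
    have h1 := ((h.rep hI hr a).continuous.tendsto _).comp (hV b)
    refine tendsto_nhds_unique h1 ?_
    have h2 : ∀ p, h.rep hI hr a (Y.toCLM (Λ (n p) b)) = Y.toCLM (Λ (leftMul hI a (n p)) b) := by
      intro p
      have := congr_arg (fun T => T.toCLM (Λ (n p) b)) (hY a).eq
      refine this.symm.trans ?_
      exact congr_arg _ (h.rep_apply hI hr a (n p) b)
    simp only [Function.comp_def, h2]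
    rw [tendsto_iff_norm_sub_tendsto_zero]
    have h3 : Tendsto (fun p => ((leftMul hI a (n p) - a : Λ.domain) : A)) l (𝓝 0) := by
      have := (h.tendsto_mul_snd (a : A)).sub_const (a : A)
      rwa [sub_self] at this
    have h4 := ((hτ.continuous_fst b).tendsto _).comp (h3.star.mul h3)
    have h5 := (Real.continuous_sqrt.tendsto _).comp (h4.const_mul (star b)).norm
    rw [star_zero, mul_zero, map_zero, DoubleCentralizer.zero_fst, zero_apply, mul_zero, norm_zero,
      Real.sqrt_zero] at h5
    refine squeeze_zero (fun _ => norm_nonneg _) (fun p => ?_) h5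
    refine Real.le_sqrt_of_sq_le ?_
    have := hYτ (leftMul hI a (n p) - a) b
    rwa [LinearPMap.map_sub, LinearMap.sub_apply, map_sub] at this
  -- For x* ∈ N the relation π(x*)V = Y Λ(x*) forces V* π(x)v = Λ(x*)* Y* v; such vectors span a
  -- dense subspace.
  have hVadj : IsAdjointable B V' := by
    refine isAdjointable_of_dense V' (h.dense_span_rep hI hr (D := star ⁻¹' (Λ.domain : Set A))
      (hd.preimage (starL ℂ : A ≃L⋆[ℂ] A).isOpenMap)) ?_
    rintro _ ⟨x, hx, v, rfl⟩
    refine ⟨(hA ⟨star x, hx⟩).choose ((star Y).toCLM v), fun b => ?_⟩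
    refine ((h.isAdjoint_rep hI hr x).symm _ _).symm.trans
      ((congr_arg₂ _ (hπV ⟨star x, hx⟩ b) rfl).trans ?_)
    rw [Y.isAdjoint, (hA ⟨star x, hx⟩).choose_spec]
  obtain ⟨W, hW⟩ := hVadj
  have hadj : ∀ x, IsAdjoint B (fun c => W (h.rep hI hr x (V' c)))
      (fun c => W (h.rep hI hr (star x) (V' c))) := fun x v w =>
    (hW.symm _ w).trans ((h.isAdjoint_rep hI hr x _ _).trans (hW v _))
  let σ : A →ₗ[ℂ] 𝓜(ℂ, B) :=
    { toFun := fun x => toMultiplier (hadj x)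
      map_add' := fun x y => multiplier_ext fun b => by simp [hW.symm.map_add]
      map_smul' := fun z x => multiplier_ext fun b => by simp [hW.symm.map_smul] }
  have hWc : Continuous W := hW.symm.toCLM.continuous
  refine ⟨σ, isStrict_of_tendsto fun r x l hl hx h1 h2 => tendsto_strict_iff.2
    ⟨fun b => ?_, fun b => ?_⟩, fun a₁ a₂ b₁ b₂ => ?_⟩
  · exact (hWc.tendsto _).comp (h.tendsto_rep hI hr hl hx h1 _)
  · have h3 := h.tendsto_rep hI hr (x := star x) (l := map star l) (r := r)
      (by simpa using hl) (by simpa using hx)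
      (fun a => by
        rw [tendsto_map'_iff]
        simpa [Function.comp_def] using (h2 (star a)).star) (V' (star b))
    exact ((hWc.tendsto _).comp (tendsto_map'_iff.1 h3)).star
  · change ip B (W (h.rep hI hr (star (a₂ : A) * a₁) (V' b₁))) b₂ = _
    have h3 := (hW.symm (h.rep hI hr (star (a₂ : A) * a₁) (V' b₁)) b₂)
    rw [h3, map_mul]
    change ip B (h.rep hI hr (star (a₂ : A)) (h.rep hI hr a₁ (V b₁))) (V b₂) = _
    rw [h.isAdjoint_rep, star_star, hπV, hπV]
    simpa using (Y.isAdjoint.symm (Y.toCLM (Λ a₁ b₁)) (Λ a₂ b₂)).symm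

end IsTruncation
end Dominated

/-! ### Lower semi-continuity. -/

section LowerSemicontinuity

variable {A B E : Type*} [NonUnitalCStarAlgebra A] [PartialOrder A] [StarOrderedRing A]
  [NonUnitalCStarAlgebra B] [PartialOrder B] [StarOrderedRing B]
  [NormedAddCommGroup E] [NormedSpace ℂ E] [CompleteSpace E]
  [SMul Bᵐᵒᵖ E] [CStarModule Bᵐᵒᵖ E]

namespace Adjointable

/-- For `0 ≤ T ≤ 1` also `(1 - T)² ≤ 1 - T`, in norm. -/
lemma norm_sq_sub_apply_le {T : Adjointable B E} (h0 : 0 ≤ T) (h1 : ‖T‖ ≤ 1) (v : E) :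
    ‖v - T.toCLM v‖ ^ 2 ≤ ‖ip B v v - ip B (T.toCLM v) v‖ := by
  have h2 : T ≤ 1 := (CStarAlgebra.norm_le_one_iff_of_nonneg T h0).1 h1
  have h3 := ip_apply_self_le (a := 1 - T) (sub_nonneg.2 h2) (sub_le_self 1 h0) v
  have h4 : (1 - T).toCLM v = v - T.toCLM v := rfl
  have h5 : ip B (v - T.toCLM v) v = ip B v v - ip B (T.toCLM v) v := ip_sub_left _ _ _
  rw [h4, h5] at h3
  rw [← norm_ip_self (B := B)]
  exact CStarAlgebra.norm_le_norm_of_nonneg_of_le (ip_self_nonneg _) h3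

lemma norm_sq_apply_le {T : Adjointable B E} (h0 : 0 ≤ T) (h1 : ‖T‖ ≤ 1) (v : E) :
    ‖T.toCLM v‖ ^ 2 ≤ ‖ip B (T.toCLM v) v‖ := by
  rw [← norm_ip_self (B := B)]
  exact CStarAlgebra.norm_le_norm_of_nonneg_of_le (ip_self_nonneg _)
    (ip_apply_self_le h0 ((CStarAlgebra.norm_le_one_iff_of_nonneg T h0).1 h1) v)

end Adjointable

variable {Λ : A →ₗ.[ℂ] (B →ₗ[ℂ] E)} {σ τ : A →ₗ[ℂ] 𝓜(ℂ, B)} {T R : Adjointable B E}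
variable {I : Type*} [Preorder I] [IsDirectedOrder I] [Nonempty I] {u : I → 𝓜(ℂ, A)}
  {S : I → Adjointable B E} {ρ : I → A →ₗ[ℂ] 𝓜(ℂ, B)}

namespace IsTruncation

variable (h : IsTruncation Λ u S ρ)
include h

lemma smul_rho_mem_familyG (i : I) {s : ℝ} (hs0 : 0 ≤ s) (hs1 : s < 1) :
    (s : ℂ) • ρ i ∈ familyG Λ := by
  refine ⟨s, hs0, hs1, ρ i, mem_familyF_iff.2 ⟨h.isCP i, h.isStrict i, _,
    star_mul_self_nonneg (S i), ?_, h.isGivenBy i⟩, rfl⟩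
  rw [CStarRing.norm_star_mul_self]
  exact mul_le_one₀ (h.norm_S_le i) (norm_nonneg _) (h.norm_S_le i)

/-- A common bound R of T₁ and T₂ lies in the commutant of π(A), and R ≤ C(T₁ + T₂) means that Y =
√R is dominated by the strict map C(σ₁ + σ₂). -/
lemma directedOn_familyG (hI : ∀ x : A, ∀ a ∈ Λ.domain, x * a ∈ Λ.domain) (hr : HasDenseRange Λ)
    (hd : Dense (Λ.domain : Set A)) (hc : IsNormStronglyClosed Λ) :
    DirectedOn (fun ρ₁ ρ₂ => IsCP (ρ₂ - ρ₁)) (familyG Λ) := by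
  intro σ₁ hσ₁ σ₂ hσ₂
  obtain ⟨cp₁, st₁, T₁, pos₁, n₁, g₁⟩ := mem_familyG_iff.1 hσ₁
  obtain ⟨cp₂, st₂, T₂, pos₂, n₂, g₂⟩ := mem_familyG_iff.1 hσ₂
  obtain ⟨R, hR0, hR1, hR₁, hR₂, ⟨C, hC, hRC⟩, hRc⟩ := exists_common_bound pos₁ pos₂
    (max_lt n₁ n₂) (le_max_left _ _) (le_max_right _ _)
  set Y := CFC.sqrt R
  have hYR : star Y * Y = R := by
    rw [(CFC.sqrt_nonneg R).isSelfAdjoint.star_eq, CFC.sqrt_mul_sqrt_self R hR0]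
  have hYc : ∀ x, Commute Y (h.repAdj hI hr x) := fun x =>
    (hRc _ (h.commute_repAdj hI hr g₁ x) (h.commute_repAdj hI hr g₂ x)).cfcₙ_nnreal _
  obtain ⟨σ, hσ, hg⟩ := h.exists_isGivenBy hI hr (h.isAdjointable hr) hd hc
    ((st₁.add st₂).smul C) hYc fun a b => by
      rw [(g₁.add g₂).smul (C : ℂ) a a b b, ← norm_ip_self (B := B), ← Adjointable.ip_star_mul_self,
        hYR, Complex.coe_smul]
      exact CStarAlgebra.norm_le_norm_of_nonneg_of_le (Adjointable.nonneg_iff.1 hR0 _)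
        (Adjointable.le_iff.1 hRC _)
  rw [hYR] at hg
  exact ⟨σ, mem_familyG_iff.2 ⟨h.isCP_of_isGivenBy hd hc hσ hg hR0, hσ, R, hR0, hR1, hg⟩,
    h.isCP_of_isGivenBy hd hc (hσ.sub st₁) (hg.sub g₁) (sub_nonneg.2 hR₁),
    h.isCP_of_isGivenBy hd hc (hσ.sub st₂) (hg.sub g₂) (sub_nonneg.2 hR₂)⟩

end IsTruncation

lemma eventually_netG (hσ : σ ∈ familyG Λ) : ∀ᶠ τ in netG Λ, τ ∈ familyG Λ ∧ IsCP (τ - σ) :=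
  mem_iInf_of_mem σ (mem_iInf_of_mem hσ (mem_principal_self _))

lemma isCP_sub_trans {ρ₁ ρ₂ ρ₃ : A →ₗ[ℂ] 𝓜(ℂ, B)} (h12 : IsCP (ρ₂ - ρ₁)) (h23 : IsCP (ρ₃ - ρ₂)) :
    IsCP (ρ₃ - ρ₁) := by
  have := h23.add h12
  rwa [sub_add_sub_cancel] at this

lemma neBot_netG (hdir : DirectedOn (fun ρ₁ ρ₂ => IsCP (ρ₂ - ρ₁)) (familyG Λ)) :
    (netG Λ).NeBot := by
  have h0 : (0 : A →ₗ[ℂ] 𝓜(ℂ, B)) ∈ familyG Λ :=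
    mem_familyG_iff.2 ⟨isCP_zero, isStrict_zero, 0, le_rfl, by simp, fun _ _ _ _ => by simp⟩
  rw [netG, iInf_subtype']
  have : Nonempty (familyG Λ) := ⟨⟨0, h0⟩⟩
  refine iInf_neBot_of_directed' ?_ fun σ => principal_neBot_iff.2 ⟨σ.1, σ.2, ?_⟩
  · intro σ τ
    obtain ⟨ω, hω, h1, h2⟩ := hdir σ.1 σ.2 τ.1 τ.2
    exact ⟨⟨ω, hω⟩, principal_mono.2 fun κ hκ => ⟨hκ.1, isCP_sub_trans h1 hκ.2⟩,
      principal_mono.2 fun κ hκ => ⟨hκ.1, isCP_sub_trans h2 hκ.2⟩⟩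
  · rw [sub_self]; exact isCP_zero

namespace IsTruncation

variable (h : IsTruncation Λ u S ρ)
include h

/-- The operators defining the maps in `familyG Λ` converge strongly to `1`. -/
lemma eventually_norm_sub_apply_lt (hr : HasDenseRange Λ) (v : E) {ε : ℝ} (hε : 0 < ε) :
    ∀ᶠ σ in netG Λ, ∀ T : Adjointable B E, 0 ≤ T → ‖T‖ ≤ 1 → IsGivenBy Λ σ T →
      ‖T.toCLM v - v‖ < ε := by
  -- Every σ above s ρ_i has s S_i* S_i ≤ T ≤ 1, so ‖v − Tv‖² ≤ ‖⟨v, v⟩ − s⟨S_i v, S_i v⟩‖.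
  obtain ⟨s, i, hs0, hs1, hs⟩ : ∃ (s : ℝ) (i : I), 0 ≤ s ∧ s < 1 ∧
      ‖ip B v v - s • ip B ((S i).toCLM v) ((S i).toCLM v)‖ < ε ^ 2 := by
    have h1 : Tendsto (fun p : ℝ × I => ‖ip B v v - p.1 • ip B ((S p.2).toCLM v) ((S p.2).toCLM v)‖)
        (𝓝[<] 1 ×ˢ atTop) (𝓝 ‖ip B v v - (1 : ℝ) • ip B v v‖) := by
      refine (tendsto_const_nhds.sub (Tendsto.smul ?_ ?_)).norm
      · exact (tendsto_nhdsWithin_of_tendsto_nhds tendsto_id).comp tendsto_fst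
      · exact tendsto_ip ((h.tendsto_S v).comp tendsto_snd) ((h.tendsto_S v).comp tendsto_snd)
    rw [one_smul, sub_self, norm_zero] at h1
    have h3 : ∀ᶠ s : ℝ in 𝓝[<] 1, 0 ≤ s ∧ s < 1 := by
      filter_upwards [self_mem_nhdsWithin, mem_nhdsWithin_of_mem_nhds
        (Ioi_mem_nhds (zero_lt_one (α := ℝ)))] with s h1 h2
      exact ⟨le_of_lt h2, h1⟩
    have h2 : ∀ᶠ p : ℝ × I in 𝓝[<] 1 ×ˢ atTop, 0 ≤ p.1 ∧ p.1 < 1 := tendsto_fst.eventually h3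
    obtain ⟨p, hp, hp'⟩ := (h2.and (h1.eventually (gt_mem_nhds (by positivity : 0 < ε ^ 2)))).exists
    exact ⟨p.1, p.2, hp.1, hp.2, hp'⟩
  filter_upwards [eventually_netG (h.smul_rho_mem_familyG i hs0 hs1)] with σ hσ T hT0 hT1 hT
  have h1 := Adjointable.nonneg_iff.1
    ((hT.sub ((h.isGivenBy i).smul (s : ℂ))).nonneg hσ.2 hr) v
  have h2 : ip B ((T - (s : ℂ) • (star (S i) * S i)).toCLM v) v =
      ip B (T.toCLM v) v - s • ip B ((S i).toCLM v) ((S i).toCLM v) := by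
    rw [← Adjointable.ip_star_mul_self, ← ip_real_smul_left, ← ip_sub_left]
    rfl
  rw [h2, sub_nonneg] at h1
  have h3 : ip B (T.toCLM v) v ≤ ip B v v :=
    Adjointable.le_iff.1 ((CStarAlgebra.norm_le_one_iff_of_nonneg T hT0).1 hT1) v
  have h4 : ‖ip B v v - ip B (T.toCLM v) v‖ ≤
      ‖ip B v v - s • ip B ((S i).toCLM v) ((S i).toCLM v)‖ :=
    CStarAlgebra.norm_le_norm_of_nonneg_of_le (sub_nonneg.2 h3) (sub_le_sub_left h1 _)
  rw [norm_sub_rev]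
  exact lt_of_pow_lt_pow_left₀ 2 hε.le
    (((Adjointable.norm_sq_sub_apply_le hT0 hT1 v).trans h4).trans_lt hs)

variable (hA : ∀ a, IsAdjointable B (Λ a))

lemma tendsto_netG_star_mul (hr : HasDenseRange Λ) (b a : Λ.domain) :
    Tendsto (fun σ : A →ₗ[ℂ] 𝓜(ℂ, B) => σ (star (b : A) * a)) (netG Λ)
      (@nhds _ (strictTopology B) (gramMul hA 1 b a)) := by
  classical
  -- The value 1 outside G is irrelevant, as the net stays in G.
  let T : (A →ₗ[ℂ] 𝓜(ℂ, B)) → Adjointable B E := fun σ =>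
    if hσ : σ ∈ familyG Λ then (mem_familyG_iff.1 hσ).2.2.choose else 1
  have hT : ∀ σ ∈ familyG Λ, 0 ≤ T σ ∧ ‖T σ‖ < 1 ∧ IsGivenBy Λ σ (T σ) := fun σ hσ => by
    simp only [T, dif_pos hσ]
    exact (mem_familyG_iff.1 hσ).2.2.choose_spec
  have hG : ∀ᶠ σ in netG Λ, σ ∈ familyG Λ :=
    (eventually_netG (h.smul_rho_mem_familyG (Classical.arbitrary I) le_rfl one_pos)).mono
      fun σ hσ => hσ.1
  have h1 : ∀ v, Tendsto (fun σ => (T σ).toCLM v) (netG Λ) (𝓝 v) := fun v => by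
    rw [Metric.tendsto_nhds]
    intro ε hε
    filter_upwards [hG, h.eventually_norm_sub_apply_lt hr v hε] with σ hσ h2
    rw [dist_eq_norm]
    exact h2 _ (hT σ hσ).1 (hT σ hσ).2.1.le (hT σ hσ).2.2
  have h2 : ∀ v, Tendsto (fun σ => (star (T σ)).toCLM v) (netG Λ)
      (𝓝 ((star (1 : Adjointable B E)).toCLM v)) := fun v => by
    rw [star_one]
    refine (h1 v).congr' ?_
    filter_upwards [hG] with σ hσ
    rw [(hT σ hσ).1.isSelfAdjoint.star_eq]
  refine (tendsto_gramMul hA h1 h2 b a).congr' ?_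
  filter_upwards [hG] with σ hσ
  exact (eq_gramMul hA fun c d => (hT σ hσ).2.2 a b c d).symm

lemma tendsto_netG_weight (hr : HasDenseRange Λ) (x : (h.weight hA).domain) :
    Tendsto (fun σ : A →ₗ[ℂ] 𝓜(ℂ, B) => σ x) (netG Λ)
      (@nhds _ (strictTopology B) (h.weight hA x)) := by
  -- Asking both nets for a common limit makes the claim stable under sums and multiples.
  suffices hs : ∀ x ∈ gramDomain Λ, ∃ m,
      Tendsto (fun i => ρ i x) atTop (@nhds _ (strictTopology B) m) ∧
      Tendsto (fun σ : A →ₗ[ℂ] 𝓜(ℂ, B) => σ x) (netG Λ) (@nhds _ (strictTopology B) m) by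
    obtain ⟨m, hm1, hm2⟩ := hs x x.2
    rwa [tendsto_strict_unique (h.tendsto_weight hA x) hm1]
  intro x hx
  induction hx using Submodule.span_induction with
  | mem x hx =>
    obtain ⟨a, ha, b, hb, rfl⟩ := hx
    exact ⟨_, h.tendsto_rho_mul hA ⟨b, hb⟩ ⟨a, ha⟩, h.tendsto_netG_star_mul hA hr ⟨b, hb⟩ ⟨a, ha⟩⟩
  | zero =>
    refine ⟨0, ?_, ?_⟩
    · simpa using tendsto_strict_iff.2 ⟨fun _ => tendsto_const_nhds, fun _ => tendsto_const_nhds⟩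
    · simpa using tendsto_strict_iff.2 ⟨fun _ => tendsto_const_nhds, fun _ => tendsto_const_nhds⟩
  | add x y _ _ hx hy =>
    obtain ⟨m, hm, hm'⟩ := hx
    obtain ⟨n, hn, hn'⟩ := hy
    exact ⟨m + n, by simpa using tendsto_strict_add hm hn,
      by simpa using tendsto_strict_add hm' hn'⟩
  | smul z x _ hx =>
    obtain ⟨m, hm, hm'⟩ := hx
    exact ⟨z • m, by simpa using tendsto_strict_smul z hm,
      by simpa using tendsto_strict_smul z hm'⟩

/-- If the net `familyG Λ` converges strictly at `a* a`, then `a` is in the domain of `Λ`. -/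
lemma mem_of_tendsto_netG (hd : Dense (Λ.domain : Set A)) (hc : IsNormStronglyClosed Λ)
    [(netG Λ).NeBot] {a : A} {m : 𝓜(ℂ, B)}
    (hm : Tendsto (fun σ : A →ₗ[ℂ] 𝓜(ℂ, B) => σ (star a * a)) (netG Λ)
      (@nhds _ (strictTopology B) m)) : a ∈ Λ.domain := by
  let a' : I → Λ.domain := fun i => ⟨(u i).snd a, h.snd_mem hd hc i a⟩
  refine (hc.mem_of_cauchy (f := a') (h.tendsto_u_snd a) fun b => ?_).1
  set v : I → E := fun i => Λ (a' i) b
  have hlim : Tendsto (fun σ : A →ₗ[ℂ] 𝓜(ℂ, B) => star b * (σ (star a * a)).fst b) (netG Λ)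
      (𝓝 (star b * m.fst b)) := ((tendsto_strict_iff.1 hm).1 b).const_mul _
  have hle : ∀ σ ∈ familyG Λ, star b * (σ (star a * a)).fst b ≤ star b * m.fst b := by
    intro σ hσ
    refine sub_nonneg.1 (CStarAlgebra.isClosed_nonneg.mem_of_tendsto (hlim.sub_const _) ?_)
    filter_upwards [eventually_netG hσ] with τ hτ
    have := hτ.2.star_mul_nonneg (star_mul_self_nonneg a) b
    simpa [mul_sub] using this
  -- Here ⟨v_i, v_i⟩ = b* ρ_i(a* a) b, and s ρ_i ∈ G for s < 1; let s tend to 1.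
  have hv : ∀ i, ip B (v i) (v i) ≤ star b * m.fst b := by
    intro i
    have h1 : Tendsto (fun s : ℝ => star b * m.fst b - s • ip B (v i) (v i)) (𝓝[<] 1)
        (𝓝 (star b * m.fst b - (1 : ℝ) • ip B (v i) (v i))) :=
      tendsto_const_nhds.sub ((tendsto_nhdsWithin_of_tendsto_nhds tendsto_id).smul_const _)
    rw [one_smul] at h1
    refine sub_nonneg.1 (CStarAlgebra.isClosed_nonneg.mem_of_tendsto h1 ?_)
    filter_upwards [self_mem_nhdsWithin, mem_nhdsWithin_of_mem_nhds
      (Ioi_mem_nhds (zero_lt_one (α := ℝ)))] with s hs1 hs0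
    have h2 := hle _ (h.smul_rho_mem_familyG i (le_of_lt hs0) hs1)
    refine sub_nonneg.2 (le_trans (le_of_eq ?_) h2)
    rw [← h.gram_snd hd hc]
    simp [mul_smul_comm]
  refine Metric.cauchy_iff.2 ⟨inferInstance, fun ε hε => ?_⟩
  obtain ⟨σ, hσ, hσε⟩ : ∃ σ ∈ familyG Λ,
      ‖star b * m.fst b - star b * (σ (star a * a)).fst b‖ < (ε / 3) ^ 2 := by
    have h1 := (hlim.const_sub (star b * m.fst b)).norm
    rw [sub_self, norm_zero] at h1
    have hG := eventually_netG (h.smul_rho_mem_familyG (Classical.arbitrary I) le_rfl one_pos)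
    obtain ⟨σ, h2, h3⟩ :=
      (hG.and (h1.eventually (gt_mem_nhds (by positivity : 0 < (ε / 3) ^ 2)))).exists
    exact ⟨σ, h2.1, h3⟩
  obtain ⟨-, hstrict, T, hT0, hT1, hT⟩ := mem_familyG_iff.1 hσ
  have hTip : ∀ c : Λ.domain, ip B (T.toCLM (Λ c b)) (Λ c b) =
      star b * (σ (star (c : A) * c)).fst b := fun c => (hT c c b b).symm
  have hcont := hstrict.continuous_fst b
  -- ‖v_i − Tv_i‖² ≤ ‖⟨v_i, v_i⟩ − ⟨Tv_i, v_i⟩‖ ≤ ‖b* m b − ⟨Tv_i, v_i⟩‖, and ⟨Tv_i, v_i⟩ → b* σ(a*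
  -- a) b by norm continuity of σ.
  have h1 : ∀ᶠ i in atTop, ‖v i - T.toCLM (v i)‖ < ε / 3 := by
    have h2 : Tendsto (fun i => ‖star b * m.fst b - ip B (T.toCLM (v i)) (v i)‖) atTop
        (𝓝 ‖star b * m.fst b - star b * (σ (star a * a)).fst b‖) := by
      simp only [v, hTip]
      exact ((((hcont.tendsto _).comp ((h.tendsto_u_snd a).star.mul
        (h.tendsto_u_snd a))).const_mul _).const_sub _).norm
    filter_upwards [h2.eventually (gt_mem_nhds hσε)] with i hi
    refine lt_of_pow_lt_pow_left₀ 2 (by positivity)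
      ((Adjointable.norm_sq_sub_apply_le hT0 hT1.le (v i)).trans_lt (lt_of_le_of_lt ?_ hi))
    refine CStarAlgebra.norm_le_norm_of_nonneg_of_le (sub_nonneg.2 ?_) (sub_le_sub_right (hv i) _)
    exact Adjointable.le_iff.1 ((CStarAlgebra.norm_le_one_iff_of_nonneg T hT0).1 hT1.le) _
  -- For this fixed σ, ‖T Λ(c)b‖² ≤ ‖b* σ(c* c) b‖ with c = a u_i − a u_j → 0.
  have h2 : Cauchy (map (fun i => T.toCLM (v i)) atTop) := by
    refine cauchy_map_of_tendsto_norm_sq ?_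
    have h3 : Tendsto (fun p : I × I => ((a' p.1 - a' p.2 : Λ.domain) : A)) (atTop ×ˢ atTop)
        (𝓝 (a - a)) := ((h.tendsto_u_snd a).comp tendsto_fst).sub
          ((h.tendsto_u_snd a).comp tendsto_snd)
    have h4 := (((hcont.tendsto _).comp (h3.star.mul h3)).const_mul (star b)).norm
    rw [sub_self, star_zero, mul_zero, map_zero, DoubleCentralizer.zero_fst, zero_apply, mul_zero,
      norm_zero] at h4
    refine squeeze_zero (fun _ => by positivity) (fun p => ?_) h4
    have h5 := Adjointable.norm_sq_apply_le hT0 hT1.le (Λ (a' p.1 - a' p.2) b)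
    rw [hTip] at h5
    rwa [LinearPMap.map_sub, LinearMap.sub_apply, map_sub] at h5
  obtain ⟨t, ht, ht'⟩ := (Metric.cauchy_iff.1 h2).2 (ε / 3) (by positivity)
  refine ⟨v '' {i | T.toCLM (v i) ∈ t ∧ ‖v i - T.toCLM (v i)‖ < ε / 3},
    image_mem_map (by filter_upwards [mem_map.1 ht, h1] with i hi hi' using ⟨hi, hi'⟩), ?_⟩
  rintro _ ⟨i, ⟨hi, hi'⟩, rfl⟩ _ ⟨j, ⟨hj, hj'⟩, rfl⟩
  have h6 := ht' _ hi _ hj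
  rw [dist_eq_norm] at h6 ⊢
  rw [norm_sub_rev] at hj'
  have h7 : v i - v j = (v i - T.toCLM (v i)) + (T.toCLM (v i) - T.toCLM (v j)) +
      (T.toCLM (v j) - v j) := by abel
  rw [h7]
  refine norm_add₃_le.trans_lt ?_
  linarith

lemma isLowerSemicontinuous_weight (hI : ∀ x : A, ∀ a ∈ Λ.domain, x * a ∈ Λ.domain)
    (hr : HasDenseRange Λ) (hd : Dense (Λ.domain : Set A)) (hc : IsNormStronglyClosed Λ) :
    IsLowerSemicontinuous (h.weight hA) Λ where
  directed := h.directedOn_familyG hI hr hd hc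
  posDomain_eq := by
    have := neBot_netG (h.directedOn_familyG hI hr hd hc)
    ext x
    refine ⟨fun hx => ⟨hx.1, _, h.tendsto_netG_weight hA hr ⟨x, hx.2⟩⟩, fun ⟨hx, m, hm⟩ => ⟨hx, ?_⟩⟩
    obtain ⟨a, rfl⟩ := CStarAlgebra.nonneg_iff_eq_star_mul_self.1 hx
    have ha := h.mem_of_tendsto_netG hd hc hm
    exact star_mul_mem_gramDomain ha ha
  tendsto x _ := h.tendsto_netG_weight hA hr x

end IsTruncation
end LowerSemicontinuity

end CStarValued

theorem corollary7p1 {A B E : Type*} {I : Type uI}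
    [NonUnitalCStarAlgebra A] [PartialOrder A] [StarOrderedRing A]
    [NonUnitalCStarAlgebra B] [PartialOrder B] [StarOrderedRing B]
    [NormedAddCommGroup E] [NormedSpace ℂ E] [CompleteSpace E]
    [SMul Bᵐᵒᵖ E] [CStarModule Bᵐᵒᵖ E]
    [Preorder I] [IsDirectedOrder I] [Nonempty I]
    (Λ : A →ₗ.[ℂ] (B →ₗ[ℂ] E))
    (hΛ_ideal : ∀ x : A, ∀ a ∈ Λ.domain, x * a ∈ Λ.domain)
    (hΛ_dense : Dense (Λ.domain : Set A))
    (hΛ_closed : CStarValued.IsNormStronglyClosed Λ)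
    (hΛ_range : CStarValued.HasDenseRange Λ)
    (u : I → 𝓜(ℂ, A)) (hu : CStarValued.IsTruncatingNet Λ u) :
    (∀ a : Λ.domain, CStarValued.IsAdjointable B (Λ a)) ∧
    ∃ φ : A →ₗ.[ℂ] 𝓜(ℂ, B),
      CStarValued.IsGramMap Λ φ ∧
      (∀ ψ : A →ₗ.[ℂ] 𝓜(ℂ, B), CStarValued.IsGramMap Λ ψ → ψ = φ) ∧
      CStarValued.IsWeight φ ∧
      CStarValued.IsDenselyDefined φ ∧
      CStarValued.sqDomain φ = (Λ.domain : Set A) ∧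
      (∃ π : A →ₙₐ[ℂ] (E →L[ℂ] E),
        CStarValued.IsKSGNS φ Λ π ∧ CStarValued.IsNondegenerate π ∧
        ∀ π' : A →ₙₐ[ℂ] (E →L[ℂ] E), CStarValued.IsKSGNS φ Λ π' → π' = π) ∧
      CStarValued.IsLowerSemicontinuous φ Λ ∧
      CStarValued.IsRegular.{uI} φ Λ ∧
      CStarValued.IsTruncatingNet Λ u := by
  obtain ⟨S, ρ, h⟩ := hu.exists_isTruncation
  have hA := h.isAdjointable hΛ_range
  have hlsc := h.isLowerSemicontinuous_weight hA hΛ_ideal hΛ_range hΛ_dense hΛ_closed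
  have hdd : CStarValued.IsDenselyDefined (h.weight hA) := CStarValued.dense_gramDomain hΛ_dense
  have hK := h.isKSGNS_rep hΛ_ideal hΛ_range hA hΛ_dense hΛ_closed
  exact ⟨hA, h.weight hA, h.isGramMap_weight hA, fun ψ hψ => (h.isGramMap_weight hA).unique hA hψ,
    h.isWeight_weight hA hΛ_dense hΛ_closed, hdd, h.sqDomain_weight hA hΛ_dense hΛ_closed,
    ⟨_, hK, h.isNondegenerate_rep hΛ_ideal hΛ_range, fun π' hπ' => hK.unique hπ'⟩,
    hlsc, ⟨hdd, hlsc, I, inferInstance, inferInstance, inferInstance, u, hu⟩, hu⟩
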